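/- For integers $m,n\ge 3$, $r\in\mathbb Z_n^*$ with $r^m=1$ and $t\in\mathbb Z_n$ with $t(r-1)=0$, let $\mathcal Y(m,n;r,t)$ be the graph with vertices $u_i^j$ ($i\in\mathbb Z_m$, $j\in\mathbb Z_n$) and edges $u_i^j\sim u_i^{j+r^i}$ for all $i\in\{0,\dots,m-1\}$, $u_i^j\sim u_{i+1}^j$ for $i\ne m-1$, and $u_{m-1}^j\sim u_0^{j+t}$. A graph $G$ is half-arc-transitive if $\mathrm{Aut}\,G$ is transitive on vertices and on edges but not on arcs; an $\mathrm{Aut}\,G$-orbit of arcs is then an orientation $D_G$ of $G$, unique up to reversal. For quartic such $G$, an alternating cycle is a cycle of even length in which every other vertex is the tail, and every other vertex the head, in $D_G$, of both its edges on the cycle. The radius is half the common length of the alternating cycles, and the attachment number is the number of common vertices of any two distinct alternating cycles that meet; $G$ is tightly attached if these two numbers are equal. For $m\ge1$, $n\ge2$, $G$ is a weak $(m,n)$-metacirculant relative to $(\rho,\sigma)$ if $\rho,\sigma\in\mathrm{Aut}\,G$, $\rho$ has exactly $m$ orbits, all of length $n$, $\sigma^{-1}\rho\sigma=\rho^{s}$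 for some $s\in\mathbb Z_n^*$, and $\sigma$ permutes the orbits of $\rho$ in one cycle of length $m$. It is of Class II if $\rho,\sigma$ can be chosen so that, moreover, each orbit of $\rho$ induces a $2$-regular subgraph and is joined by edges to exactly two other orbits, each vertex of the orbit having exactly one neighbour in each of these two. Let $X=\mathcal Y(4,48;13,44)$. Then $X$ is half-arc-transitive. Let $D_X$ be the $\mathrm{Aut}\,X$-orbit of the arc $(u_0^0,u_0^1)$. For a prime $p\ge5$ let $\mathcal C_p(X)$ be the regular $\mathbb Z_p$-cover of $X$ in which every arc of $D_X$ has voltage $1$ (and its inverse voltage $-1$): its vertex set is $V(X)\times\mathbb Z_p$, and its edges join $(u,k)$ and $(v,k+1)$ for every arc $u\to v$ of $D_X$ and every $k\in\mathbb Z_p$. Then for every prime $p\ge5$: (1) $\mathcal C_p(X)\cong\mathcal Y(4,48p;r,t)$, where $r\in\mathbb Z_{48p}^*$ and $t\in\mathbb Z_{48p}$ are given by $r\equiv13\pmod{48}$, $r\equiv1\pmod p$, $t\equiv44\pmod{48}$, $t\equiv4\pmod p$ (and $r^4=1$, $t(r-1)=0$); (2) every automorphism of $X$ lifts to an automorphism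 of $\mathcal C_p(X)$, and every automorphism of $\mathcal C_p(X)$ projects to an automorphism of $X$; (3) $\mathcal C_p(X)$ is a connected quartic half-arc-transitive weak $(4,48p)$-metacirculant of Class II, it has radius $12$ and attachment number $3$, and hence is not tightly attached. Consequently there are infinitely many pairwise non-isomorphic (indeed, of infinitely many orders) finite connected quartic half-arc-transitive weak metacirculants of Class II with radius $12$ and attachment number $3$; in particular, these are not tightly attached. -/

import Mathlib

/-! ### Symmetry of graphs -/

/-- The automorphism group of `G` is transitive on vertices. -/
def IsVertexTransitive {V : Type*} (G : SimpleGraph V) : Prop :=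
  ∀ u v : V, ∃ g : G ≃g G, g u = v

/-- The automorphism group of `G` is transitive on (undirected) edges. -/
def IsEdgeTransitive {V : Type*} (G : SimpleGraph V) : Prop :=
  ∀ e ∈ G.edgeSet, ∀ f ∈ G.edgeSet, ∃ g : G ≃g G, Sym2.map g e = f

/-- The automorphism group of `G` is transitive on arcs (ordered pairs of adjacent vertices). -/
def IsArcTransitive {V : Type*} (G : SimpleGraph V) : Prop :=
  ∀ a b c d : V, G.Adj a b → G.Adj c d → ∃ g : G ≃g G, g a = c ∧ g b = d

/-- Half-arc-transitive: vertex- and edge- but not arc-transitive. -/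
def IsHalfArcTransitive {V : Type*} (G : SimpleGraph V) : Prop :=
  IsVertexTransitive G ∧ IsEdgeTransitive G ∧ ¬ IsArcTransitive G

/-- Every vertex has exactly four neighbours. -/
def IsQuartic {V : Type*} (G : SimpleGraph V) : Prop :=
  ∀ v : V, (G.neighborSet v).ncard = 4

/-! ### The orientation of a half-arc-transitive graph, radius, attachment number -/

/-- The orbital digraph: the orbit of the arc `(a, b)` under the automorphism group of `G`.
`arcOrbit G a b u v` says that `u → v`. -/
def arcOrbit {V : Type*} (G : SimpleGraph V) (a b : V) (u v : V) : Prop :=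
  ∃ g : G ≃g G, g a = u ∧ g b = v

/-- `D` is one of the oriented graphs associated with the action of the automorphism group
of `G`. If `G` is half-arc-transitive, there are exactly two, each the reverse of the other. -/
def IsNaturalOrientation {V : Type*} (G : SimpleGraph V) (D : V → V → Prop) : Prop :=
  ∃ a b : V, G.Adj a b ∧ D = arcOrbit G a b

/-- An even length cycle (as a subgraph of `G`), alternating with respect to `D`: every other
vertex is the tail, and every other vertex the head, of both its incident edges on the cycle.
The closed walk traversing it is taken to start at a tail. -/
def IsAlternatingCycle {V : Type*} {G : SimpleGraph V} (D : V → V → Prop) (C : G.Subgraph) :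
    Prop :=
  ∃ (v : V) (w : G.Walk v v), w.IsCycle ∧ Even w.length ∧ w.toSubgraph = C ∧
    ∀ i < w.length,
      (Even i → D (w.getVert i) (w.getVert (i + 1))) ∧
      (Odd i → D (w.getVert (i + 1)) (w.getVert i))

/-- There are alternating cycles, and all of them have length `2 * k`. -/
def HasRadius {V : Type*} (G : SimpleGraph V) (k : ℕ) : Prop :=
  ∀ D, IsNaturalOrientation G D →
    (∃ C : G.Subgraph, IsAlternatingCycle D C) ∧
    ∀ C : G.Subgraph, IsAlternatingCycle D C → C.verts.ncard = 2 * k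

/-- There are two adjacent (that is, distinct and with a common vertex) alternating cycles,
and any two such intersect in exactly `k` vertices. -/
def HasAttachmentNumber {V : Type*} (G : SimpleGraph V) (k : ℕ) : Prop :=
  ∀ D, IsNaturalOrientation G D →
    (∃ C C' : G.Subgraph, IsAlternatingCycle D C ∧ IsAlternatingCycle D C' ∧ C ≠ C' ∧
      (C.verts ∩ C'.verts).Nonempty) ∧
    ∀ C C' : G.Subgraph, IsAlternatingCycle D C → IsAlternatingCycle D C' → C ≠ C' →
      (C.verts ∩ C'.verts).Nonempty → (C.verts ∩ C'.verts).ncard = k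

/-- The attachment number equals the radius. -/
def IsTightlyAttached {V : Type*} (G : SimpleGraph V) : Prop :=
  ∃ k, HasRadius G k ∧ HasAttachmentNumber G k

/-! ### Weak metacirculants and Class II -/

/-- The orbit of `v` under the cyclic group generated by `ρ`. -/
def rotOrbit {V : Type*} {G : SimpleGraph V} (ρ : G ≃g G) (v : V) : Set V :=
  Set.range fun k : ℤ => (ρ ^ k) v

/-- The set of all orbits of the cyclic group generated by `ρ`. -/
def rotOrbits {V : Type*} {G : SimpleGraph V} (ρ : G ≃g G) : Set (Set V) :=
  Set.range (rotOrbit ρ)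

/-- `ρ` has `m` orbits of length `n` and no other orbit. -/
def IsSemiregularAut {V : Type*} {G : SimpleGraph V} (m n : ℕ) (ρ : G ≃g G) : Prop :=
  (rotOrbits ρ).ncard = m ∧ ∀ v, (rotOrbit ρ v).ncard = n

/-- `G` is a weak `(m, n)`-metacirculant relative to `(ρ, σ)`. Automorphisms are composed here
as functions, `(σ * ρ) v = σ (ρ v)`. -/
def IsWeakMetacirculantRel {V : Type*} (G : SimpleGraph V) (m n : ℕ) (ρ σ : G ≃g G) : Prop :=
  1 ≤ m ∧ 2 ≤ n ∧ IsSemiregularAut m n ρ ∧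
  (∃ r : (ZMod n)ˣ, σ * ρ * σ⁻¹ = ρ ^ (r : ZMod n).val) ∧
  ∃ X : ZMod m → Set V, Function.Injective X ∧ Set.range X = rotOrbits ρ ∧
    ∀ i, σ '' X i = X (i + 1)

/-- The Class II condition: the subgraph induced by each orbit of `ρ` has all degrees `2`, and
each orbit is joined to exactly two other orbits, to each of them by a single edge of the
quotient multigraph (each vertex has exactly one neighbour in such an orbit). -/
def IsClassIIRel {V : Type*} (G : SimpleGraph V) (ρ : G ≃g G) : Prop :=
  (∀ v, (G.neighborSet v ∩ rotOrbit ρ v).ncard = 2) ∧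
  ∀ O ∈ rotOrbits ρ,
    {O' ∈ rotOrbits ρ | O' ≠ O ∧ ∃ u ∈ O, ∃ w ∈ O', G.Adj u w}.ncard = 2 ∧
    ∀ O' ∈ rotOrbits ρ, O' ≠ O → (∃ u ∈ O, ∃ w ∈ O', G.Adj u w) →
      ∀ u ∈ O, (G.neighborSet u ∩ O').ncard = 1

/-- `G` is a weak `(m, n)`-metacirculant of Class II. -/
def IsWeakMetacirculantClassII {V : Type*} (G : SimpleGraph V) (m n : ℕ) : Prop :=
  ∃ ρ σ : G ≃g G, IsWeakMetacirculantRel G m n ρ σ ∧ IsClassIIRel G ρ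

/-! ### The graphs `Y(m,n;r,t)` and regular covers -/

/-- The graph `Y(m,n;r,t)`; the pair `(i, j)` is the vertex `u_i^j`. -/
def graphY (m n : ℕ) (r t : ZMod n) : SimpleGraph (ZMod m × ZMod n) :=
  SimpleGraph.fromRel fun x y =>
    (y.1 = x.1 ∧ y.2 = x.2 + r ^ x.1.val) ∨
    (x.1 ≠ -1 ∧ y.1 = x.1 + 1 ∧ y.2 = x.2) ∨
    (x.1 = -1 ∧ y.1 = 0 ∧ y.2 = x.2 + t)

/-- Voltages in `A` on the darts of a graph, with inverse darts carrying inverse voltages. -/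
structure VoltageAssignment (V A : Type*) [AddGroup A] where
  volt : V → V → A
  volt_symm : ∀ u v, volt v u = -volt u v

/-- The regular `A`-cover of `G` derived from a voltage assignment; the pair `(u, k)` is the
vertex in the fibre over `u` with label `k`. -/
def derivedGraph {V A : Type*} [AddGroup A] (G : SimpleGraph V) (ζ : VoltageAssignment V A) :
    SimpleGraph (V × A) where
  Adj x y := G.Adj x.1 y.1 ∧ y.2 = x.2 + ζ.volt x.1 y.1
  symm := by
    constructor
    rintro x y ⟨h, e⟩
    exact ⟨h.symm, by rw [e, ζ.volt_symm x.1 y.1, add_neg_cancel_right]⟩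
  loopless := ⟨fun x h => G.loopless.irrefl x.1 h.1⟩

open Classical in
/-- The voltage assignment of an oriented graph `D` in which every dart `u → v` gets voltage `1`
(and its inverse `-1`). -/
noncomputable def unitVoltage {V : Type*} (D : V → V → Prop) (p : ℕ) :
    VoltageAssignment V (ZMod p) where
  volt u v := (if D u v then 1 else 0) - (if D v u then 1 else 0)
  volt_symm u v := by rw [neg_sub]

/-- The graph `X = Y(4,48;13,44)`. -/
def graphX : SimpleGraph (ZMod 4 × ZMod 48) := graphY 4 48 13 44

/-- The oriented graph of the action of `Aut X` on `X` in which `u_0^0 → u_0^1`. -/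
def orientX : ZMod 4 × ZMod 48 → ZMod 4 × ZMod 48 → Prop := arcOrbit graphX (0, 0) (0, 1)

/-- The regular `ℤ_p`-cover `C_p(X)`. -/
noncomputable def coverX (p : ℕ) : SimpleGraph ((ZMod 4 × ZMod 48) × ZMod p) :=
  derivedGraph graphX (unitVoltage orientX p)

/-!
The graph `X` and its covers belong to one family. If `χ` identifies `ℤ_n` with `ℤ_48 × ℤ_q`, let
`torusGraph χ` be `Y(4, n; r, t)` with `r`, `t` corresponding to `(13, 1)`, `(44, 4)`. For `q = 1`
it is `X`, and for a prime `q = p ≥ 5` it is isomorphic to `C_p(X)`: in the coordinates of the cover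
all steps add `1` to the `ℤ_p`-component, and subtracting the number of the layer turns this into
the steps of `Y(4, 48p; r, t)` (`coverIso`).

The edges of `torusGraph χ` are the steps `x → a x` and `x → b x` of two permutations, `stepA`
inside the layers and `stepB` between them, and this digraph is the natural orientation. Writing
`r = 1 + f` and `t = 4e` with `f² = 4f = 0`, `e² = 1`, `ef = -f`, the rotation and the shift of the
layers commute with `a` and `b` and act transitively on the vertices, and an explicit involution
(`flipIso`) exchanges `a` and `b`.

The main point is that there are no other automorphisms (`commutes_or_exchanges`). The number of
walks of length `6` between two neighbours of a vertex tells the pairs `{a x, a⁻¹ x}` and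
`{b x, b⁻¹ x}` from all others (`walkCount_neighbors`). It is found by a finite enumeration which is
the same for all covers: the closed walks of length `8` involved have net voltage `0` or `±8`, and
`±8` is zero in `ℤ_q` for `q = 1` and nonzero for `q ≥ 5` prime. Hence automorphisms respect the
lines along `a` and along `b`, and up to the involution they preserve each of the two kinds. Such an
automorphism permutes the layers, so it traverses all lines of one kind in the same direction;
finally a reversal of a direction would force `2t = 0` or `r³ = r`. So every automorphism commutes
with `a` and `b` or exchanges them (`RigidSystem`), which gives half-arc-transitivity and the
orientation. Automorphisms of `X` lift because they preserve the orientation, and those of the cover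
project because `a⁴⁸ = b⁴⁸` is a generator of the covering group.

A cycle alternating with respect to the orientation follows `a` and `b⁻¹` in turn, so its tails form
an orbit of `b⁻¹ a` and its heads an orbit of `a b⁻¹`. Both permutations move layers back by one,
have the common fourth power `x ↦ x + (32, 0)`, of order `3`, and orbits of length `12`; an orbit of
the first and one of the second that meet do so in an orbit of this fourth power, as two invariants
modulo `16` show (`AlternatingSystem`). This gives radius `12` and attachment number `3`.
-/

/-! ### Permutations -/

theorem Equiv.Perm.apply_inv_apply {V : Type*} (a : Equiv.Perm V) (x : V) : a (a⁻¹ x) = x :=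
  a.apply_symm_apply x

theorem Equiv.Perm.inv_apply_apply {V : Type*} (a : Equiv.Perm V) (x : V) : a⁻¹ (a x) = x :=
  a.symm_apply_apply x

theorem Equiv.Perm.apply_zpow_of_apply_add {V A : Type*} [AddCommGroup A] (c : Equiv.Perm V)
    (F : V → A) (d : A) (hF : ∀ x, F (c x) = F x + d) (k : ℤ) (x : V) :
    F ((c ^ k) x) = F x + k • d := by
  induction k using Int.induction_on with
  | zero => simp
  | succ k ih =>
    rw [add_comm, zpow_add, zpow_one, Equiv.Perm.mul_apply, hF, ih, add_smul, one_smul]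
    abel
  | pred k ih =>
    have h := hF ((c ^ (-(k : ℤ) - 1)) x)
    rw [← Equiv.Perm.mul_apply, ← zpow_one_add, add_sub_cancel, ih] at h
    rw [eq_sub_of_add_eq h.symm, sub_smul, one_smul]
    abel

theorem ZMod.add_one_ne_self_four : ∀ x : ZMod 4, x + 1 ≠ x := by decide

/-! ### Graphs carried by two permutations -/

/-- The digraph in which every vertex `x` has the out-neighbours `a x` and `b x`. -/
def StepArc {V : Type*} (a b : Equiv.Perm V) (x y : V) : Prop := y = a x ∨ y = b x

theorem StepArc.swap {V : Type*} {a b : Equiv.Perm V} {x y : V} :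
    StepArc b a x y ↔ StepArc a b x y := or_comm

theorem StepArc.inv {V : Type*} {a b : Equiv.Perm V} {x y : V} :
    StepArc a⁻¹ b⁻¹ x y ↔ StepArc a b y x := by
  simp only [StepArc, Equiv.Perm.eq_inv_iff_eq, eq_comm]

/-- The graph `G` is the underlying graph of the digraph `StepArc a b`, and there are a cyclic
grading and period conditions that control the cycles alternating between `a` and `b`: these
cycles have length `24`, and two of them meet in the orbit of a vertex under `(b⁻¹ a)⁴`. -/
structure AlternatingSystem {V : Type*} (G : SimpleGraph V) (a b : Equiv.Perm V) : Prop where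
  adj_iff : ∀ x y, G.Adj x y ↔ StepArc a b x y ∨ StepArc a b y x
  grading : ∃ l : V → ZMod 4, ∀ x, l (a x) = l x + 1 ∧ l (b x) = l x + 1
  period : ∀ (k : ℤ) (z : V), ((b⁻¹ * a) ^ k) z = z ↔ 12 ∣ k
  pow_four : (b⁻¹ * a) ^ (4 : ℤ) = (a * b⁻¹) ^ (4 : ℤ)
  meet : ∀ (k l : ℤ) (z : V), ((b⁻¹ * a) ^ k) z = ((a * b⁻¹) ^ l) z → 4 ∣ k ∧ 4 ∣ l

namespace AlternatingSystem

variable {V : Type*} {G : SimpleGraph V} {a b : Equiv.Perm V}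

theorem inv_mul_zpow (a b : Equiv.Perm V) (k : ℤ) : (a⁻¹ * b) ^ k = (b⁻¹ * a) ^ (-k) := by
  rw [zpow_neg, ← inv_zpow, mul_inv_rev, inv_inv]

theorem mul_inv_zpow (a b : Equiv.Perm V) (k : ℤ) : (b * a⁻¹) ^ k = (a * b⁻¹) ^ (-k) := by
  rw [zpow_neg, ← inv_zpow, mul_inv_rev, inv_inv]

theorem conj_zpow (a b : Equiv.Perm V) (k : ℤ) : (a * b⁻¹) ^ k = a * (b⁻¹ * a) ^ k * a⁻¹ := by
  rw [← _root_.conj_zpow]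
  congr 1
  group

theorem zpow_succ_apply (a b : Equiv.Perm V) (k : ℤ) (v : V) :
    ((b⁻¹ * a) ^ (k + 1)) v = b⁻¹ (a (((b⁻¹ * a) ^ k) v)) := by
  rw [add_comm, zpow_add, zpow_one, Equiv.Perm.mul_apply, Equiv.Perm.mul_apply]

theorem apply_zpow_succ (a b : Equiv.Perm V) (k : ℤ) (v : V) :
    b (((b⁻¹ * a) ^ (k + 1)) v) = a (((b⁻¹ * a) ^ k) v) := by
  rw [zpow_succ_apply, Equiv.Perm.apply_inv_apply]

theorem swap (h : AlternatingSystem G a b) : AlternatingSystem G b a where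
  adj_iff x y := by rw [h.adj_iff, StepArc.swap, StepArc.swap (x := y)]
  grading := h.grading.imp fun _ hl x => (hl x).symm
  period k z := by rw [inv_mul_zpow, h.period, dvd_neg]
  pow_four := by
    rw [inv_mul_zpow, mul_inv_zpow, zpow_neg, zpow_neg, h.pow_four]
  meet k l z hz := by
    rw [inv_mul_zpow, mul_inv_zpow] at hz
    simpa using h.meet _ _ _ hz

theorem inv (h : AlternatingSystem G a b) : AlternatingSystem G a⁻¹ b⁻¹ where
  adj_iff x y := by rw [h.adj_iff, StepArc.inv, StepArc.inv, or_comm]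
  grading := by
    obtain ⟨l, hl⟩ := h.grading
    refine ⟨fun x => -l x, fun x => ⟨?_, ?_⟩⟩
    · have := (hl (a⁻¹ x)).1
      rw [Equiv.Perm.apply_inv_apply] at this
      beta_reduce
      rw [this]; ring
    · have := (hl (b⁻¹ x)).2
      rw [Equiv.Perm.apply_inv_apply] at this
      beta_reduce
      rw [this]; ring
  period k z := by
    rw [inv_inv, mul_inv_zpow, conj_zpow, Equiv.Perm.mul_apply, Equiv.Perm.mul_apply,
      ← Equiv.Perm.eq_inv_iff_eq, h.period, dvd_neg]
  pow_four := by
    simp only [inv_inv]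
    rw [mul_inv_zpow, inv_mul_zpow, zpow_neg, zpow_neg, h.pow_four]
  meet k l z hz := by
    simp only [inv_inv] at hz
    rw [mul_inv_zpow, inv_mul_zpow] at hz
    simpa using (h.meet _ _ _ hz.symm).symm

/-! ### Alternating cycles -/

/-- The orbit of `v` under `b⁻¹ a`: the tails of the alternating cycle on which `v` is a tail. -/
def tails (a b : Equiv.Perm V) (v : V) : Set V := {x | ∃ k : ℤ, x = ((b⁻¹ * a) ^ k) v}

theorem mem_tails_self (a b : Equiv.Perm V) (v : V) : v ∈ tails a b v := ⟨0, by simp⟩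

theorem tails_swap (a b : Equiv.Perm V) (v : V) : tails b a v = tails a b v := by
  ext x
  constructor <;> rintro ⟨k, rfl⟩ <;> exact ⟨-k, by rw [inv_mul_zpow _ _ _]⟩

theorem tails_eq_of_mem {v x : V} (hx : x ∈ tails a b v) : tails a b x = tails a b v := by
  obtain ⟨k, rfl⟩ := hx
  ext y
  constructor
  · rintro ⟨l, rfl⟩
    exact ⟨l + k, by rw [zpow_add, Equiv.Perm.mul_apply]⟩
  · rintro ⟨l, rfl⟩
    exact ⟨l - k, by rw [← Equiv.Perm.mul_apply, ← zpow_add, sub_add_cancel]⟩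

theorem inv_apply_mem_tails {v x : V} (hx : x ∈ tails a b v) : b⁻¹ (a x) ∈ tails a b v := by
  obtain ⟨k, rfl⟩ := hx
  exact ⟨1 + k, by rw [zpow_add, zpow_one, Equiv.Perm.mul_apply, Equiv.Perm.mul_apply]⟩

theorem inv_apply_mem_tails' {v x : V} (hx : x ∈ tails a b v) : a⁻¹ (b x) ∈ tails a b v := by
  rw [← tails_swap] at hx ⊢
  exact inv_apply_mem_tails hx

/-- The alternating cycle on which `v` is a tail. -/
def altCycle (h : AlternatingSystem G a b) (v : V) : G.Subgraph where
  verts := tails a b v ∪ a '' tails a b v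
  Adj x y := (x ∈ tails a b v ∧ StepArc a b x y) ∨ (y ∈ tails a b v ∧ StepArc a b y x)
  adj_sub {x y} hxy := (h.adj_iff x y).2 (hxy.imp And.right And.right)
  edge_vert {x y} hxy := by
    rcases hxy with hxy | ⟨hy, rfl | rfl⟩
    · exact Or.inl hxy.1
    · exact Or.inr ⟨y, hy, rfl⟩
    · exact Or.inr ⟨a⁻¹ (b y), inv_apply_mem_tails' hy, by simp⟩
  symm := ⟨fun x y hxy => Or.symm hxy⟩

theorem altCycle_congr (h : AlternatingSystem G a b) {v w : V}
    (hvw : tails a b v = tails a b w) : h.altCycle v = h.altCycle w := by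
  simp only [altCycle, hvw]

theorem altCycle_swap (h : AlternatingSystem G a b) (v : V) :
    h.swap.altCycle v = h.altCycle v := by
  have hv : b '' tails a b v = a '' tails a b v := by
    ext x
    constructor
    · rintro ⟨y, hy, rfl⟩
      exact ⟨_, inv_apply_mem_tails' hy, by simp⟩
    · rintro ⟨y, hy, rfl⟩
      exact ⟨_, inv_apply_mem_tails hy, by simp⟩
  refine SimpleGraph.Subgraph.ext ?_ ?_
  · simp only [altCycle, tails_swap, hv]
  · ext x y
    simp only [altCycle, tails_swap, StepArc.swap (a := a)]

theorem ne_of_not_dvd (h : AlternatingSystem G a b) {k l : ℤ} (hkl : ¬ 12 ∣ k - l) (z : V) :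
    ((b⁻¹ * a) ^ k) z ≠ ((b⁻¹ * a) ^ l) z := by
  intro hz
  refine hkl ((h.period _ z).1 ?_)
  rw [sub_eq_neg_add, zpow_add, Equiv.Perm.mul_apply, hz, zpow_neg, Equiv.Perm.inv_apply_apply]

theorem zpow_congr (h : AlternatingSystem G a b) {k l : ℤ} (hkl : 12 ∣ k - l) (z : V) :
    ((b⁻¹ * a) ^ k) z = ((b⁻¹ * a) ^ l) z := by
  have := (h.period _ (((b⁻¹ * a) ^ l) z)).2 hkl
  rwa [← Equiv.Perm.mul_apply, ← zpow_add, sub_add_cancel] at this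

theorem grading_zpow {l : V → ZMod 4} (hl : ∀ x, l (a x) = l x + 1 ∧ l (b x) = l x + 1)
    {v x : V} (hx : x ∈ tails a b v) : l x = l v := by
  have key : ∀ x, l ((b⁻¹ * a) x) = l x := fun x => by
    have h1 := (hl (b⁻¹ (a x))).2
    rw [Equiv.Perm.apply_inv_apply, (hl x).1] at h1
    exact (add_right_cancel h1).symm
  obtain ⟨k, rfl⟩ := hx
  simpa using Equiv.Perm.apply_zpow_of_apply_add _ l 0 (by simpa using key) k v

theorem tails_eq_image (h : AlternatingSystem G a b) (v : V) :
    tails a b v = (fun k : ℕ => ((b⁻¹ * a) ^ (k : ℤ)) v) '' (Finset.range 12 : Set ℕ) := by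
  ext x
  constructor
  · rintro ⟨k, rfl⟩
    refine ⟨(k % 12).toNat, by simp; omega, h.zpow_congr ?_ v⟩
    omega
  · rintro ⟨k, -, rfl⟩
    exact ⟨k, rfl⟩

theorem ncard_tails (h : AlternatingSystem G a b) (v : V) : (tails a b v).ncard = 12 := by
  rw [h.tails_eq_image, Set.InjOn.ncard_image, Set.ncard_coe_finset, Finset.card_range]
  intro k hk l hl hkl
  simp only [Finset.coe_range, Set.mem_Iio] at hk hl
  by_contra hne
  exact h.ne_of_not_dvd (by omega) v hkl

theorem finite_tails (h : AlternatingSystem G a b) (v : V) : (tails a b v).Finite :=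
  Set.finite_of_ncard_pos (by rw [h.ncard_tails]; norm_num)

theorem ncard_altCycle_verts (h : AlternatingSystem G a b) (v : V) :
    (h.altCycle v).verts.ncard = 24 := by
  obtain ⟨l, hl⟩ := h.grading
  have hd : Disjoint (tails a b v) (a '' tails a b v) := by
    rw [Set.disjoint_left]
    rintro _ hx ⟨y, hy, rfl⟩
    have h1 := grading_zpow hl hx
    rw [(hl y).1, grading_zpow hl hy] at h1
    exact (ZMod.add_one_ne_self_four _ h1).elim
  change (tails a b v ∪ a '' tails a b v).ncard = 24
  rw [Set.ncard_union_eq hd (h.finite_tails v) ((h.finite_tails v).image _),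
    Set.ncard_image_of_injective _ a.injective, h.ncard_tails]

theorem ncard_inter_of_mem (h : AlternatingSystem G a b) {v w z : V} (hv : z ∈ tails a b v)
    (hw : z ∈ a '' tails a b w) :
    ((h.altCycle v).verts ∩ (h.altCycle w).verts).ncard = 3 := by
  obtain ⟨l, hl⟩ := h.grading
  obtain ⟨u, hu, rfl⟩ := hw
  have hlv := grading_zpow hl hv
  have hlw := grading_zpow hl hu
  rw [(hl u).1, hlw] at hlv
  have key : (h.altCycle v).verts ∩ (h.altCycle w).verts =
      (fun k : ℕ => ((b⁻¹ * a) ^ (4 * k : ℤ)) (a u)) '' (Finset.range 3 : Set ℕ) := by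
    rw [altCycle_congr h (tails_eq_of_mem hv).symm, altCycle_congr h (tails_eq_of_mem hu).symm]
    ext y
    constructor
    · rintro ⟨hy | ⟨x, hx, rfl⟩, hy' | ⟨x', hx', hxx⟩⟩
      · have h1 := grading_zpow hl hy
        rw [grading_zpow hl hy', (hl u).1] at h1
        exact (ZMod.add_one_ne_self_four _ h1.symm).elim
      · obtain ⟨k, rfl⟩ := hy
        obtain ⟨m, rfl⟩ := hx'
        have h1 := h.meet k m (a u) (by
          rw [conj_zpow, Equiv.Perm.mul_apply, Equiv.Perm.mul_apply, Equiv.Perm.inv_apply_apply,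
            hxx])
        refine ⟨(k % 12 / 4).toNat, by simp; omega, h.zpow_congr ?_ _⟩
        omega
      · have h1 := grading_zpow hl hy'
        have h2 := grading_zpow hl hx
        rw [(hl x).1, h2, (hl u).1, add_assoc] at h1
        exact absurd h1 (by simpa using by decide)
      · have h1 := grading_zpow hl hx
        have h2 := congrArg l hxx
        rw [(hl x).1, (hl x').1, h1, grading_zpow hl hx', (hl u).1] at h2
        exact (ZMod.add_one_ne_self_four _ h2.symm).elim
    · rintro ⟨k, -, rfl⟩
      refine ⟨Or.inl ⟨_, rfl⟩, Or.inr ⟨((b⁻¹ * a) ^ (4 * k : ℤ)) u, ⟨_, rfl⟩, ?_⟩⟩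
      have h1 : ((a * b⁻¹) ^ (4 * k : ℤ)) (a u) = ((b⁻¹ * a) ^ (4 * k : ℤ)) (a u) := by
        rw [zpow_mul, zpow_mul, h.pow_four]
      beta_reduce
      rw [← h1, conj_zpow, Equiv.Perm.mul_apply, Equiv.Perm.mul_apply, Equiv.Perm.inv_apply_apply]
  rw [key, Set.InjOn.ncard_image, Set.ncard_coe_finset, Finset.card_range]
  intro k hk m hm hkm
  simp only [Finset.coe_range, Set.mem_Iio] at hk hm
  by_contra hne
  exact h.ne_of_not_dvd (by omega) _ hkm

theorem ncard_inter (h : AlternatingSystem G a b) {v w : V} (hne : h.altCycle v ≠ h.altCycle w)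
    (hmeet : ((h.altCycle v).verts ∩ (h.altCycle w).verts).Nonempty) :
    ((h.altCycle v).verts ∩ (h.altCycle w).verts).ncard = 3 := by
  obtain ⟨z, hz | hz, hz' | hz'⟩ := hmeet
  · exact absurd (h.altCycle_congr ((tails_eq_of_mem hz).symm.trans (tails_eq_of_mem hz'))) hne
  · exact h.ncard_inter_of_mem hz hz'
  · rw [Set.inter_comm]
    exact h.ncard_inter_of_mem hz' hz
  · obtain ⟨x, hx, rfl⟩ := hz
    obtain ⟨x', hx', hxx⟩ := hz'
    obtain rfl := a.injective hxx
    exact absurd (h.altCycle_congr ((tails_eq_of_mem hx).symm.trans (tails_eq_of_mem hx'))) hne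

/-- A cycle that leaves `v` along `a` and alternates afterwards uses `a` and `b⁻¹` in turn. -/
theorem getVert_of_alternating {v : V} {w : G.Walk v v} (hw : w.IsCycle)
    (halt : ∀ i < w.length,
      (Even i → StepArc a b (w.getVert i) (w.getVert (i + 1))) ∧
      (Odd i → StepArc a b (w.getVert (i + 1)) (w.getVert i)))
    (h1 : w.getVert 1 = a v) (k : ℕ) :
    (2 * k ≤ w.length → w.getVert (2 * k) = ((b⁻¹ * a) ^ (k : ℤ)) v) ∧
    (2 * k + 1 ≤ w.length → w.getVert (2 * k + 1) = a (((b⁻¹ * a) ^ (k : ℤ)) v)) := by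
  have hback : ∀ i, i + 2 ≤ w.length → w.getVert i ≠ w.getVert (i + 2) := fun i hi =>
    hw.getVert_sub_one_ne_getVert_add_one (i := i + 1) (by omega)
  induction k with
  | zero => simp [h1]
  | succ k ih =>
    have even_step : 2 * (k + 1) ≤ w.length →
        w.getVert (2 * (k + 1)) = ((b⁻¹ * a) ^ ((k + 1 : ℕ) : ℤ)) v := by
      intro hk
      have e1 := ih.1 (by omega)
      have e2 := ih.2 (by omega)
      have hne := hback (2 * k) (by omega)
      rw [Nat.cast_succ, zpow_succ_apply, ← e2, Equiv.Perm.eq_inv_iff_eq]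
      rcases (halt (2 * k + 1) (by omega)).2 ⟨k, rfl⟩ with h2 | h2
      · rw [e2, ← e1] at h2
        exact absurd (a.injective h2) hne
      · exact h2.symm
    refine ⟨even_step, fun hk => ?_⟩
    have e1 := even_step (by omega)
    have hne := hback (2 * k + 1) (by omega)
    rcases (halt (2 * (k + 1)) (by omega)).1 (even_two_mul _) with h2 | h2
    · rw [h2, e1]
    · refine absurd ?_ hne
      rw [show 2 * k + 1 + 2 = 2 * (k + 1) + 1 by ring, h2, e1, ih.2 (by omega), Nat.cast_succ,
        apply_zpow_succ]

theorem length_of_alternating (h : AlternatingSystem G a b) {v : V} {w : G.Walk v v}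
    (hw : w.IsCycle) (heven : Even w.length)
    (hg : ∀ k : ℕ, 2 * k ≤ w.length → w.getVert (2 * k) = ((b⁻¹ * a) ^ (k : ℤ)) v) :
    w.length = 24 := by
  obtain ⟨m, hm⟩ := heven
  have h3 := hw.three_le_length
  have e1 := hg m (by omega)
  rw [show 2 * m = w.length by omega, w.getVert_length, eq_comm, h.period] at e1
  by_contra hne
  have e2 := hg 12 (by omega)
  rw [(h.period _ v).2 (by norm_num)] at e2
  have := hw.getVert_injOn' (by simp only [Set.mem_ofPred_eq]; omega)
    (by simp only [Set.mem_ofPred_eq]; omega) (e2.trans w.getVert_zero.symm)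
  omega

/-- A closed walk of length `24` using `a` and `b⁻¹` in turn traverses `altCycle`. -/
theorem toSubgraph_eq_altCycle (h : AlternatingSystem G a b) {v : V} {w : G.Walk v v}
    (hlen : w.length = 24)
    (hg : ∀ k : ℕ, (2 * k ≤ w.length → w.getVert (2 * k) = ((b⁻¹ * a) ^ (k : ℤ)) v) ∧
      (2 * k + 1 ≤ w.length → w.getVert (2 * k + 1) = a (((b⁻¹ * a) ^ (k : ℤ)) v))) :
    w.toSubgraph = h.altCycle v := by
  have ha : ∀ x ∈ tails a b v, ∀ y, StepArc a b x y → w.toSubgraph.Adj x y := by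
    rintro _ ⟨k, rfl⟩ y hy
    rw [SimpleGraph.Walk.toSubgraph_adj_iff]
    rcases hy with rfl | rfl
    · refine ⟨2 * (k % 12).toNat, ?_, by omega⟩
      rw [(hg _).1 (by omega), (hg _).2 (by omega)]
      rw [h.zpow_congr (k := ((k % 12).toNat : ℤ)) (l := k) (by omega)]
    · refine ⟨2 * ((k - 1) % 12).toNat + 1, ?_, by omega⟩
      have := (hg (((k - 1) % 12).toNat + 1)).1 (by omega)
      rw [mul_add, mul_one] at this
      rw [(hg _).2 (by omega), this, Sym2.eq_swap, h.zpow_congr (l := k) (by push_cast; omega),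
        h.zpow_congr (k := (((k - 1) % 12).toNat : ℤ)) (l := k - 1) (by omega)]
      rw [← apply_zpow_succ, sub_add_cancel]
  refine SimpleGraph.Subgraph.ext ?_ ?_
  · ext x
    rw [SimpleGraph.Walk.mem_verts_toSubgraph, SimpleGraph.Walk.mem_support_iff_exists_getVert]
    constructor
    · rintro ⟨i, rfl, hi⟩
      obtain ⟨k, rfl | rfl⟩ := Nat.even_or_odd' i
      · exact Or.inl ⟨k, (hg k).1 hi⟩
      · exact Or.inr ⟨_, ⟨k, rfl⟩, ((hg k).2 hi).symm⟩
    · rintro (hx | ⟨y, hy, rfl⟩)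
      · have := SimpleGraph.Walk.mem_support_of_adj_toSubgraph (ha x hx _ (Or.inl rfl))
        rwa [SimpleGraph.Walk.mem_support_iff_exists_getVert] at this
      · have := SimpleGraph.Walk.mem_support_of_adj_toSubgraph (ha y hy _ (Or.inl rfl)).symm
        rwa [SimpleGraph.Walk.mem_support_iff_exists_getVert] at this
  · ext x y
    constructor
    · rw [SimpleGraph.Walk.toSubgraph_adj_iff]
      rintro ⟨i, hi, hlt⟩
      have : (h.altCycle v).Adj (w.getVert i) (w.getVert (i + 1)) := by
        obtain ⟨k, rfl | rfl⟩ := Nat.even_or_odd' i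
        · rw [(hg k).1 (by omega), (hg k).2 (by omega)]
          exact Or.inl ⟨⟨k, rfl⟩, Or.inl rfl⟩
        · have e := (hg (k + 1)).1 (by omega)
          rw [mul_add, mul_one] at e
          rw [(hg k).2 (by omega), e]
          refine Or.inr ⟨⟨_, rfl⟩, Or.inr ?_⟩
          rw [Nat.cast_succ, apply_zpow_succ]
      rcases Sym2.eq_iff.1 hi with ⟨rfl, rfl⟩ | ⟨rfl, rfl⟩
      · exact this
      · exact this.symm
    · rintro (⟨hx, hxy⟩ | ⟨hy, hyx⟩)
      · exact ha x hx y hxy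
      · exact (ha y hy x hyx).symm

theorem exists_eq_altCycle (h : AlternatingSystem G a b) {C : G.Subgraph}
    (hC : IsAlternatingCycle (StepArc a b) C) : ∃ v, C = h.altCycle v := by
  obtain ⟨v, w, hw, heven, rfl, halt⟩ := hC
  refine ⟨v, ?_⟩
  have h0 := (halt 0 (by have := hw.three_le_length; omega)).1 (by simp)
  rw [w.getVert_zero] at h0
  rcases h0 with h0 | h0
  · have hg := getVert_of_alternating hw halt h0
    exact h.toSubgraph_eq_altCycle (h.length_of_alternating hw heven fun k => (hg k).1) hg
  · have hg := getVert_of_alternating (a := b) (b := a) hw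
      (by simpa only [StepArc.swap] using halt) h0
    rw [← altCycle_swap]
    exact h.swap.toSubgraph_eq_altCycle (h.swap.length_of_alternating hw heven fun k => (hg k).1)
      hg

theorem _root_.SimpleGraph.exists_walk_getVert_eq {V : Type*} {G : SimpleGraph V} (n : ℕ) :
    ∀ s : ℕ → V, (∀ i, G.Adj (s i) (s (i + 1))) →
      ∃ w : G.Walk (s 0) (s n), w.length = n ∧ ∀ i ≤ n, w.getVert i = s i := by
  induction n with
  | zero =>
    intro s _
    exact ⟨.nil, rfl, fun i hi => by obtain rfl : i = 0 := by omega
                                     rfl⟩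
  | succ n ih =>
    intro s hs
    obtain ⟨w, hlen, hw⟩ := ih (fun i => s (i + 1)) fun i => hs (i + 1)
    refine ⟨.cons (hs 0) w, by simp [hlen], fun i hi => ?_⟩
    cases i with
    | zero => simp
    | succ i => rw [SimpleGraph.Walk.getVert_cons_succ, hw i (by omega)]

theorem isAlternatingCycle_altCycle (h : AlternatingSystem G a b) (v : V) :
    IsAlternatingCycle (StepArc a b) (h.altCycle v) := by
  obtain ⟨l, hl⟩ := h.grading
  let s : ℕ → V := fun i => if Even i then ((b⁻¹ * a) ^ ((i / 2 : ℕ) : ℤ)) v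
    else a (((b⁻¹ * a) ^ ((i / 2 : ℕ) : ℤ)) v)
  have s_even : ∀ k, s (2 * k) = ((b⁻¹ * a) ^ (k : ℤ)) v := fun k => by simp [s]
  have s_odd : ∀ k, s (2 * k + 1) = a (((b⁻¹ * a) ^ (k : ℤ)) v) := fun k => by
    have : (2 * k + 1) / 2 = k := by omega
    simp only [s, this, Nat.not_even_bit1, if_false]
  have s_next : ∀ k, s (2 * k + 1) = b (s (2 * k + 1 + 1)) := fun k => by
    rw [show 2 * k + 1 + 1 = 2 * (k + 1) by ring, s_even, s_odd, Nat.cast_succ, apply_zpow_succ]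
  have harc : ∀ i, (Even i → StepArc a b (s i) (s (i + 1))) ∧
      (Odd i → StepArc a b (s (i + 1)) (s i)) := by
    refine fun i => ⟨?_, ?_⟩
    · rw [even_iff_exists_two_mul]
      rintro ⟨k, rfl⟩
      rw [s_even, s_odd]
      exact Or.inl rfl
    · rintro ⟨k, rfl⟩
      exact Or.inr (s_next k)
  have hinj : ∀ i j, 0 < i → i ≤ 24 → 0 < j → j ≤ 24 → s i = s j → i = j := by
    intro i j hi0 hi hj0 hj hij
    have hgr : ∀ k : ℤ, l (((b⁻¹ * a) ^ k) v) = l v := fun k => grading_zpow hl ⟨k, rfl⟩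
    obtain ⟨k, rfl | rfl⟩ := Nat.even_or_odd' i <;> obtain ⟨m, rfl | rfl⟩ := Nat.even_or_odd' j
    · rw [s_even, s_even] at hij
      by_contra hne
      exact h.ne_of_not_dvd (by omega) v hij
    · rw [s_even, s_odd] at hij
      have := congrArg l hij
      rw [(hl _).1, hgr, hgr] at this
      exact (ZMod.add_one_ne_self_four _ this.symm).elim
    · rw [s_even, s_odd] at hij
      have := congrArg l hij
      rw [(hl _).1, hgr, hgr] at this
      exact (ZMod.add_one_ne_self_four _ this).elim
    · rw [s_odd, s_odd] at hij
      by_contra hne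
      exact h.ne_of_not_dvd (by omega) v (a.injective hij)
  obtain ⟨w, hlen, hw⟩ := SimpleGraph.exists_walk_getVert_eq (G := G) 24 s fun i => by
    rw [h.adj_iff]
    rcases Nat.even_or_odd i with hi | hi
    · exact Or.inl ((harc i).1 hi)
    · exact Or.inr ((harc i).2 hi)
  have h0 : s 0 = v := by simpa using s_even 0
  have h24 : s 24 = v := by
    rw [show 24 = 2 * 12 by norm_num, s_even]
    exact (h.period _ v).2 (by norm_num)
  have hw' : ∀ i ≤ 24, (w.copy h0 h24).getVert i = s i := fun i hi => by
    rw [SimpleGraph.Walk.getVert_copy, hw i hi]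
  have hlen' : (w.copy h0 h24).length = 24 := by rw [SimpleGraph.Walk.length_copy, hlen]
  generalize w.copy h0 h24 = c at hw' hlen'
  refine ⟨v, c, ?_, by rw [hlen']; decide, ?_, fun i hi => ?_⟩
  · rw [SimpleGraph.Walk.isCycle_iff_isPath_tail_and_le_length]
    refine ⟨?_, by omega⟩
    have hn : ¬ c.Nil := by
      rw [← SimpleGraph.Walk.length_eq_zero_iff]
      omega
    have htl := SimpleGraph.Walk.length_tail_add_one hn
    rw [SimpleGraph.Walk.isPath_iff_injective_get_support]
    rintro ⟨i, hi⟩ ⟨j, hj⟩ hij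
    rw [SimpleGraph.Walk.length_support] at hi hj
    simp only [List.get_eq_getElem, SimpleGraph.Walk.support_getElem_eq_getVert,
      SimpleGraph.Walk.getVert_tail] at hij
    rw [hw' _ (by omega), hw' _ (by omega)] at hij
    have := hinj _ _ (by omega) (by omega) (by omega) (by omega) hij
    ext
    simp only
    omega
  · refine h.toSubgraph_eq_altCycle hlen' fun k => ⟨fun hk => ?_, fun hk => ?_⟩
    · rw [hw' _ (by omega), s_even]
    · rw [hw' _ (by omega), s_odd]
  · rw [hw' i (by omega), hw' (i + 1) (by omega)]
    exact harc i

/-- The values of radius and attachment number, for one of the two orientations. -/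
theorem radius_attachment [Nonempty V] (h : AlternatingSystem G a b) :
    ((∃ C : G.Subgraph, IsAlternatingCycle (StepArc a b) C) ∧
      ∀ C : G.Subgraph, IsAlternatingCycle (StepArc a b) C → C.verts.ncard = 2 * 12) ∧
    (∃ C C' : G.Subgraph, IsAlternatingCycle (StepArc a b) C ∧
      IsAlternatingCycle (StepArc a b) C' ∧ C ≠ C' ∧ (C.verts ∩ C'.verts).Nonempty) ∧
    ∀ C C' : G.Subgraph, IsAlternatingCycle (StepArc a b) C →
      IsAlternatingCycle (StepArc a b) C' → C ≠ C' →
      (C.verts ∩ C'.verts).Nonempty → (C.verts ∩ C'.verts).ncard = 3 := by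
  obtain ⟨v⟩ := ‹Nonempty V›
  have h3 : ((h.altCycle (a v)).verts ∩ (h.altCycle v).verts).ncard = 3 :=
    h.ncard_inter_of_mem (mem_tails_self _ _ _) ⟨v, mem_tails_self _ _ _, rfl⟩
  refine ⟨⟨⟨_, h.isAlternatingCycle_altCycle v⟩, fun C hC => ?_⟩,
    ⟨_, _, h.isAlternatingCycle_altCycle (a v), h.isAlternatingCycle_altCycle v, fun he => ?_, ?_⟩,
    fun C C' hC hC' hne hm => ?_⟩
  · obtain ⟨u, rfl⟩ := h.exists_eq_altCycle hC
    exact h.ncard_altCycle_verts u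
  · rw [he, Set.inter_self, h.ncard_altCycle_verts] at h3
    norm_num at h3
  · exact Set.nonempty_of_ncard_ne_zero (by rw [h3]; norm_num)
  · obtain ⟨u, rfl⟩ := h.exists_eq_altCycle hC
    obtain ⟨u', rfl⟩ := h.exists_eq_altCycle hC'
    exact h.ncard_inter hne hm

theorem hasRadius_and_hasAttachmentNumber [Nonempty V] (h : AlternatingSystem G a b)
    (hD : ∀ D, IsNaturalOrientation G D → D = StepArc a b ∨ D = StepArc a⁻¹ b⁻¹) :
    HasRadius G 12 ∧ HasAttachmentNumber G 3 := by
  refine ⟨fun D hn => ?_, fun D hn => ?_⟩ <;> rcases hD D hn with rfl | rfl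
  · exact h.radius_attachment.1
  · exact h.inv.radius_attachment.1
  · exact h.radius_attachment.2
  · exact h.inv.radius_attachment.2

end AlternatingSystem

/-! ### Graphs whose automorphisms preserve or exchange two permutations -/

/-- The map `s` commutes with both `a` and `b`. -/
def Commutes {V : Type*} (a b : Equiv.Perm V) (s : V → V) : Prop :=
  ∀ x, s (a x) = a (s x) ∧ s (b x) = b (s x)

/-- The map `s` carries `a` to `b` and `b` to `a`. -/
def Exchanges {V : Type*} (a b : Equiv.Perm V) (s : V → V) : Prop :=
  ∀ x, s (a x) = b (s x) ∧ s (b x) = a (s x)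

theorem Commutes.stepArc_iff {V : Type*} {a b : Equiv.Perm V} {s : V → V} (hs : Commutes a b s)
    (hinj : Function.Injective s) (x y : V) : StepArc a b (s x) (s y) ↔ StepArc a b x y := by
  rw [StepArc, ← (hs x).1, ← (hs x).2, hinj.eq_iff, hinj.eq_iff, StepArc]

theorem Exchanges.stepArc_iff {V : Type*} {a b : Equiv.Perm V} {s : V → V} (hs : Exchanges a b s)
    (hinj : Function.Injective s) (x y : V) : StepArc a b (s x) (s y) ↔ StepArc a b x y := by
  rw [StepArc, ← (hs x).1, ← (hs x).2, hinj.eq_iff, hinj.eq_iff, StepArc, or_comm]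

/-- The automorphism of the underlying graph of `StepArc a b` given by a permutation that
preserves this digraph. -/
def isoOfStepArc {V : Type*} {G : SimpleGraph V} {a b : Equiv.Perm V}
    (hG : ∀ x y, G.Adj x y ↔ StepArc a b x y ∨ StepArc a b y x) (s : Equiv.Perm V)
    (hs : ∀ x y, StepArc a b (s x) (s y) ↔ StepArc a b x y) : G ≃g G where
  toEquiv := s
  map_rel_iff' {x y} := by rw [hG, hG, hs, hs]

/-- The graph `G` underlies the digraph `StepArc a b`, its automorphisms are exactly symmetries of
this digraph that commute with `a` and `b` or exchange them, and both kinds are plentiful. -/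
structure RigidSystem {V : Type*} (G : SimpleGraph V) (a b : Equiv.Perm V) : Prop where
  adj_iff : ∀ x y, G.Adj x y ↔ StepArc a b x y ∨ StepArc a b y x
  asymm : ∀ x y, StepArc a b x y → ¬ StepArc a b y x
  transitive : ∀ x y, ∃ g : G ≃g G, Commutes a b g ∧ g x = y
  exchange : ∃ g : G ≃g G, Exchanges a b g
  rigid : ∀ g : G ≃g G, Commutes a b g ∨ Exchanges a b g

namespace RigidSystem

variable {V : Type*} {G : SimpleGraph V} {a b : Equiv.Perm V}

theorem stepArc_iff (h : RigidSystem G a b) (g : G ≃g G) (x y : V) :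
    StepArc a b (g x) (g y) ↔ StepArc a b x y :=
  (h.rigid g).elim (fun hg => hg.stepArc_iff g.injective x y)
    fun hg => hg.stepArc_iff g.injective x y

theorem exists_apply_eq (h : RigidSystem G a b) {x y u v : V} (hxy : StepArc a b x y)
    (huv : StepArc a b u v) : ∃ g : G ≃g G, g x = u ∧ g y = v := by
  have key : ∀ x y u v, y = a x → StepArc a b u v → ∃ g : G ≃g G, g x = u ∧ g y = v := by
    rintro x _ u v rfl (rfl | rfl)
    · obtain ⟨g, hg, rfl⟩ := h.transitive x u
      exact ⟨g, rfl, (hg x).1⟩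
    · obtain ⟨g, hg⟩ := h.exchange
      obtain ⟨s, hs, rfl⟩ := h.transitive (g x) u
      exact ⟨g.trans s, rfl, by simp [(hg x).1, (hs _).2]⟩
  rcases hxy with rfl | rfl
  · exact key _ _ _ _ rfl huv
  · obtain ⟨g, h1, h2⟩ := key x _ _ _ rfl (Or.inr rfl : StepArc a b x (b x))
    obtain ⟨g', h3, h4⟩ := key x _ _ _ rfl huv
    exact ⟨g.symm.trans g', by
      change g' (g.symm x) = u
      rw [← h3, (RelIso.symm_apply_eq g).2 h1.symm], by
      change g' (g.symm (b x)) = v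
      rw [← h4, (RelIso.symm_apply_eq g).2 h2.symm]⟩

theorem arcOrbit_eq (h : RigidSystem G a b) {x y : V} (hxy : StepArc a b x y) :
    arcOrbit G x y = StepArc a b := by
  ext u v
  constructor
  · rintro ⟨g, rfl, rfl⟩
    rwa [h.stepArc_iff]
  · exact fun huv => h.exists_apply_eq hxy huv

theorem isHalfArcTransitive [Nonempty V] (h : RigidSystem G a b) : IsHalfArcTransitive G := by
  refine ⟨fun u v => (h.transitive u v).imp fun g hg => hg.2, ?_, fun harc => ?_⟩
  · have key : ∀ e ∈ G.edgeSet, ∃ x y, StepArc a b x y ∧ e = s(x, y) := by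
      intro e he
      induction e with
      | _ x y =>
      rcases (h.adj_iff x y).1 he with hxy | hyx
      · exact ⟨x, y, hxy, rfl⟩
      · exact ⟨y, x, hyx, Sym2.eq_swap⟩
    intro e he f hf
    obtain ⟨x, y, hxy, rfl⟩ := key e he
    obtain ⟨u, v, huv, rfl⟩ := key f hf
    obtain ⟨g, rfl, rfl⟩ := h.exists_apply_eq hxy huv
    exact ⟨g, rfl⟩
  · obtain ⟨x⟩ := ‹Nonempty V›
    have hx : StepArc a b x (a x) := Or.inl rfl
    have hadj := (h.adj_iff _ _).2 (Or.inl hx)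
    obtain ⟨g, h1, h2⟩ := harc _ _ _ _ hadj hadj.symm
    refine h.asymm _ _ hx ?_
    have := (h.stepArc_iff g _ _).2 hx
    rwa [h1, h2] at this

theorem eq_stepArc_of_isNaturalOrientation (h : RigidSystem G a b) {D : V → V → Prop}
    (hD : IsNaturalOrientation G D) : D = StepArc a b ∨ D = StepArc a⁻¹ b⁻¹ := by
  obtain ⟨x, y, hxy, rfl⟩ := hD
  rcases (h.adj_iff x y).1 hxy with hxy | hyx
  · exact Or.inl (h.arcOrbit_eq hxy)
  · right
    ext u v
    rw [StepArc.inv, ← h.arcOrbit_eq hyx]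
    exact exists_congr fun g => and_comm

end RigidSystem

/-! ### The graphs `Y(4, n; r, t)` with `r ↦ (13, 1)` and `t ↦ (44, 4)` -/

section TorusGraph

variable {n q : ℕ} (χ : ZMod n ≃+* ZMod 48 × ZMod q)

/-- The graph `Y(4, n; r, t)`, where `ℤ_n` is identified with `ℤ_48 × ℤ_q` and `r`, `t` correspond
to `(13, 1)`, `(44, 4)`. -/
def torusGraph : SimpleGraph (ZMod 4 × ZMod n) := graphY 4 n (χ.symm (13, 1)) (χ.symm (44, 4))

/-- The element `r - 1` of `ℤ_n`, which corresponds to `(12, 0)` and squares to zero. -/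
def nilp : ZMod n := χ.symm (12, 0)

/-- The involution of `ℤ_n` that corresponds to `(-1, 1)`; one has `t = 4 * sgn χ`. -/
def sgn : ZMod n := χ.symm (-1, 1)

/-- The reduction `ℤ_n → ℤ_4`. -/
def redFour : ZMod n →+* ZMod 4 :=
  ((ZMod.castHom (by norm_num : 4 ∣ 48) (ZMod 4)).comp (RingHom.fst _ _)).comp χ.toRingHom

/-- The indicator of the last layer, with values in `ℤ_n`. -/
def isLast (n : ℕ) (i : ZMod 4) : ZMod n := if i = 3 then 1 else 0

theorem one_add_nil : χ.symm (13, 1) = 1 + nilp χ := by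
  rw [nilp, ← map_one χ.symm, ← map_add]
  exact congrArg χ.symm (Prod.ext (by rfl) (by simp))

theorem four_mul_sgn : χ.symm (44, 4) = 4 * sgn χ := by
  rw [sgn, ← map_ofNat χ.symm 4, ← map_mul]
  exact congrArg χ.symm (Prod.ext (by rfl) (by simp))

theorem nil_mul_nil : nilp χ * nilp χ = 0 := by
  rw [nilp, ← map_mul, ← map_zero χ.symm]
  exact congrArg χ.symm (Prod.ext (by rfl) (by simp))

theorem four_mul_nil : 4 * nilp χ = 0 := by
  rw [nilp, ← map_ofNat χ.symm 4, ← map_mul, ← map_zero χ.symm]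
  exact congrArg χ.symm (Prod.ext (by rfl) (by simp))

theorem sgn_mul_sgn : sgn χ * sgn χ = 1 := by
  rw [sgn, ← map_mul, ← map_one χ.symm]
  exact congrArg χ.symm (Prod.ext (by rfl) (by simp))

theorem sgn_mul_nil : sgn χ * nilp χ = -nilp χ := by
  rw [sgn, nilp, ← map_mul, ← map_neg]
  exact congrArg χ.symm (Prod.ext (show (-1 : ZMod 48) * 12 = -12 by decide) (by simp))

theorem redFour_nil : redFour χ (nilp χ) = 0 := by
  simp only [redFour, nilp, RingHom.comp_apply, RingEquiv.toRingHom_eq_coe, RingHom.coe_coe,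
    RingEquiv.apply_symm_apply]
  change ZMod.castHom (by norm_num : 4 ∣ 48) (ZMod 4) 12 = 0
  rw [map_ofNat]
  decide

theorem redFour_four : redFour χ 4 = 0 := by
  rw [map_ofNat]
  decide

theorem redFour_val (i : ZMod 4) : redFour χ (i.val : ZMod n) = i := by
  rw [map_natCast, ZMod.natCast_zmod_val]

theorem val_add_one (i : ZMod 4) : ((i + 1).val : ZMod n) = i.val + 1 - 4 * isLast n i := by
  have key : ∀ i : ZMod 4, (i + 1).val = if i = 3 then 0 else i.val + 1 := by decide
  rw [key, isLast]
  split_ifs with hi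
  · subst hi
    have : (3 : ZMod 4).val = 3 := rfl
    rw [this]; push_cast; ring
  · push_cast; ring

theorem pow_val (i : ZMod 4) : χ.symm (13, 1) ^ i.val = 1 + nilp χ * i.val := by
  rw [one_add_nil]
  induction i.val with
  | zero => simp
  | succ k ih =>
    rw [pow_succ, ih]
    push_cast
    linear_combination (k : ZMod n) * nil_mul_nil χ

/-- The step inside a layer, `u_i^j ↦ u_i^{j + r^i}`, where `r^i = 1 + i (r - 1)`. -/
def stepA : Equiv.Perm (ZMod 4 × ZMod n) where
  toFun x := (x.1, x.2 + (1 + nilp χ * x.1.val))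
  invFun x := (x.1, x.2 - (1 + nilp χ * x.1.val))
  left_inv x := by simp
  right_inv x := by simp

/-- The step from each layer to the next, which adds `t` when it leaves the last layer. -/
def stepB : Equiv.Perm (ZMod 4 × ZMod n) where
  toFun x := (x.1 + 1, x.2 + 4 * sgn χ * isLast n x.1)
  invFun x := (x.1 - 1, x.2 - 4 * sgn χ * isLast n (x.1 - 1))
  left_inv x := by simp
  right_inv x := by simp

theorem stepA_apply (i : ZMod 4) (j : ZMod n) :
    stepA χ (i, j) = (i, j + (1 + nilp χ * i.val)) := rfl

theorem stepB_apply (i : ZMod 4) (j : ZMod n) :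
    stepB χ (i, j) = (i + 1, j + 4 * sgn χ * isLast n i) := rfl

theorem stepB_inv_apply (i : ZMod 4) (j : ZMod n) :
    (stepB χ)⁻¹ (i, j) = (i - 1, j - 4 * sgn χ * isLast n (i - 1)) := rfl

/-- The levels: every arc of the digraph leads from a level to the next one. -/
def level (x : ZMod 4 × ZMod n) : ZMod 4 := x.1 + redFour χ x.2

theorem level_stepA (x : ZMod 4 × ZMod n) : level χ (stepA χ x) = level χ x + 1 := by
  obtain ⟨i, j⟩ := x
  simp only [level, stepA_apply, map_add, map_mul, map_one, redFour_nil]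
  ring

theorem level_stepB (x : ZMod 4 × ZMod n) : level χ (stepB χ x) = level χ x + 1 := by
  obtain ⟨i, j⟩ := x
  simp only [level, stepB_apply, map_add, map_mul, redFour_four]
  ring

theorem level_of_stepArc {x y : ZMod 4 × ZMod n} (h : StepArc (stepA χ) (stepB χ) x y) :
    level χ y = level χ x + 1 := by
  rcases h with rfl | rfl
  · exact level_stepA χ x
  · exact level_stepB χ x

theorem torusGraph_adj_iff (x y : ZMod 4 × ZMod n) : (torusGraph χ).Adj x y ↔
    StepArc (stepA χ) (stepB χ) x y ∨ StepArc (stepA χ) (stepB χ) y x := by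
  have key : ∀ x y : ZMod 4 × ZMod n, ((y.1 = x.1 ∧ y.2 = x.2 + χ.symm (13, 1) ^ x.1.val) ∨
      (x.1 ≠ -1 ∧ y.1 = x.1 + 1 ∧ y.2 = x.2) ∨
      (x.1 = -1 ∧ y.1 = 0 ∧ y.2 = x.2 + χ.symm (44, 4))) ↔ StepArc (stepA χ) (stepB χ) x y := by
    rintro ⟨i, j⟩ ⟨i', j'⟩
    rw [StepArc, stepA_apply, stepB_apply, Prod.mk.injEq, Prod.mk.injEq, pow_val, four_mul_sgn]
    have e : (-1 : ZMod 4) = 3 := by decide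
    rw [e, isLast]
    by_cases hi : i = 3
    · subst hi
      have e' : (3 + 1 : ZMod 4) = 0 := by decide
      simp [e']
    · simp [hi]
  rw [torusGraph, graphY, SimpleGraph.fromRel_adj, key, key, and_iff_right_of_imp]
  rintro (h | h) rfl <;>
    exact ZMod.add_one_ne_self_four _ (level_of_stepArc χ h).symm

theorem stepArc_asymm (x y : ZMod 4 × ZMod n) (h : StepArc (stepA χ) (stepB χ) x y) :
    ¬ StepArc (stepA χ) (stepB χ) y x := by
  intro h'
  have h1 := level_of_stepArc χ h
  rw [level_of_stepArc χ h'] at h1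
  have : ∀ z : ZMod 4, z ≠ z + 1 + 1 := by decide
  exact this _ h1

/-! ### Automorphisms -/

/-- The rotation of all layers by one step. -/
def rotPerm (n : ℕ) : Equiv.Perm (ZMod 4 × ZMod n) where
  toFun x := (x.1, x.2 + 1)
  invFun x := (x.1, x.2 - 1)
  left_inv x := by simp
  right_inv x := by simp

theorem rotPerm_commutes : Commutes (stepA χ) (stepB χ) (rotPerm n) := by
  rintro ⟨i, j⟩
  constructor
  · exact Prod.ext rfl (add_right_comm j _ _)
  · exact Prod.ext rfl (add_right_comm j _ _)

/-- The rotation as an automorphism. -/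
def rotIso : torusGraph χ ≃g torusGraph χ :=
  isoOfStepArc (torusGraph_adj_iff χ) (rotPerm n)
    ((rotPerm_commutes χ).stepArc_iff (rotPerm n).injective)

theorem rotIso_apply (i : ZMod 4) (j : ZMod n) : rotIso χ (i, j) = (i, j + 1) := rfl

/-- The map that shifts the layers cyclically and multiplies second coordinates by `r`, with the
correction `t` on the last layer. -/
def shiftPerm : Equiv.Perm (ZMod 4 × ZMod n) where
  toFun x := (x.1 + 1, (1 + nilp χ) * x.2 + 4 * sgn χ * isLast n x.1)
  invFun x := (x.1 - 1, (1 - nilp χ) * (x.2 - 4 * sgn χ * isLast n (x.1 - 1)))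
  left_inv x := by
    ext
    · simp
    · simp only [add_sub_cancel_right]
      linear_combination -x.2 * nil_mul_nil χ
  right_inv x := by
    ext
    · simp
    · simp only
      linear_combination -(x.2 - 4 * sgn χ * isLast n (x.1 - 1)) * nil_mul_nil χ

theorem shiftPerm_apply (i : ZMod 4) (j : ZMod n) :
    shiftPerm χ (i, j) = (i + 1, (1 + nilp χ) * j + 4 * sgn χ * isLast n i) := rfl

theorem shiftPerm_commutes : Commutes (stepA χ) (stepB χ) (shiftPerm χ) := by
  rintro ⟨i, j⟩
  constructor
  · rw [stepA_apply, shiftPerm_apply, shiftPerm_apply, stepA_apply, val_add_one]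
    refine Prod.ext rfl ?_
    simp only
    linear_combination (i.val : ZMod n) * nil_mul_nil χ + isLast n i * four_mul_nil χ
  · rw [stepB_apply, shiftPerm_apply, shiftPerm_apply, stepB_apply]
    refine Prod.ext rfl ?_
    simp only
    linear_combination sgn χ * isLast n i * four_mul_nil χ

/-- The cyclic shift of the layers as an automorphism. -/
def shiftIso : torusGraph χ ≃g torusGraph χ :=
  isoOfStepArc (torusGraph_adj_iff χ) (shiftPerm χ)
    ((shiftPerm_commutes χ).stepArc_iff (shiftPerm χ).injective)

/-- The involution fixing `u_0^0` that exchanges the two kinds of steps: a vertex of layer `i`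
whose second coordinate reduces to `l` modulo `4` is mapped into layer `l`. -/
def flipFun (x : ZMod 4 × ZMod n) : ZMod 4 × ZMod n :=
  (redFour χ x.2, x.1.val + sgn χ * (x.2 - (redFour χ x.2).val) +
    nilp χ * x.1.val * (redFour χ x.2).val)

theorem flipFun_apply (i : ZMod 4) (j : ZMod n) :
    flipFun χ (i, j) = (redFour χ j, i.val + sgn χ * (j - (redFour χ j).val) +
      nilp χ * i.val * (redFour χ j).val) := rfl

theorem flipFun_involutive : Function.Involutive (flipFun χ) := by
  rintro ⟨i, j⟩
  have h : redFour χ (i.val + sgn χ * (j - (redFour χ j).val) +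
      nilp χ * i.val * (redFour χ j).val) = i := by
    rw [map_add, map_add, map_mul, map_mul, map_mul, map_sub, redFour_nil, redFour_val,
      redFour_val]
    ring
  rw [flipFun_apply, flipFun_apply, h]
  refine Prod.ext rfl ?_
  simp only
  linear_combination (j - (redFour χ j).val) * sgn_mul_sgn χ +
    (i.val : ZMod n) * (redFour χ j).val * sgn_mul_nil χ

/-- The involution `flipFun` as a permutation. -/
def flipPerm : Equiv.Perm (ZMod 4 × ZMod n) := (flipFun_involutive χ).toPerm

theorem flipPerm_exchanges : Exchanges (stepA χ) (stepB χ) (flipPerm χ) := by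
  rintro ⟨i, j⟩
  change flipFun χ _ = stepB χ (flipFun χ _) ∧ flipFun χ _ = stepA χ (flipFun χ _)
  constructor
  · rw [stepA_apply, flipFun_apply, flipFun_apply, stepB_apply]
    have h : redFour χ (j + (1 + nilp χ * i.val)) = redFour χ j + 1 := by
      rw [map_add, map_add, map_mul, map_one, redFour_nil]
      ring
    rw [h, val_add_one]
    refine Prod.ext rfl ?_
    simp only
    linear_combination (i.val : ZMod n) * sgn_mul_nil χ -
      (i.val : ZMod n) * isLast n (redFour χ j) * four_mul_nil χ
  · rw [stepB_apply, flipFun_apply, flipFun_apply, stepA_apply]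
    have h : redFour χ (j + 4 * sgn χ * isLast n i) = redFour χ j := by
      rw [map_add, map_mul, map_mul, redFour_four]
      ring
    rw [h, val_add_one]
    refine Prod.ext rfl ?_
    simp only
    linear_combination 4 * isLast n i * sgn_mul_sgn χ -
      isLast n i * (redFour χ j).val * four_mul_nil χ

/-- The involution `flipFun` as an automorphism. -/
def flipIso : torusGraph χ ≃g torusGraph χ :=
  isoOfStepArc (torusGraph_adj_iff χ) (flipPerm χ)
    ((flipPerm_exchanges χ).stepArc_iff (flipPerm χ).injective)

theorem flipIso_exchanges : Exchanges (stepA χ) (stepB χ) (flipIso χ) := flipPerm_exchanges χ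

theorem flipIso_flipIso (x : ZMod 4 × ZMod n) : flipIso χ (flipIso χ x) = x := flipFun_involutive χ x

theorem Commutes.comp {V : Type*} {a b : Equiv.Perm V} {s s' : V → V} (hs : Commutes a b s)
    (hs' : Commutes a b s') : Commutes a b (s ∘ s') := fun x =>
  ⟨by simp [(hs' x).1, (hs _).1], by simp [(hs' x).2, (hs _).2]⟩

theorem Commutes.symm {V : Type*} {G : SimpleGraph V} {a b : Equiv.Perm V} {g : G ≃g G}
    (hg : Commutes a b g) : Commutes a b g.symm := fun x =>
  ⟨by rw [RelIso.symm_apply_eq, (hg _).1, g.apply_symm_apply],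
    by rw [RelIso.symm_apply_eq, (hg _).2, g.apply_symm_apply]⟩

theorem exists_commutes_apply_zero [NeZero n] (x : ZMod 4 × ZMod n) :
    ∃ g : torusGraph χ ≃g torusGraph χ, Commutes (stepA χ) (stepB χ) g ∧ g (0, 0) = x := by
  have h1 : ∀ k : ℕ, ∃ g : torusGraph χ ≃g torusGraph χ,
      Commutes (stepA χ) (stepB χ) g ∧ (g (0, 0)).1 = k := by
    intro k
    induction k with
    | zero => exact ⟨SimpleGraph.Iso.refl, fun x => ⟨rfl, rfl⟩, by simp⟩
    | succ k ih =>
      obtain ⟨g, hg, hk⟩ := ih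
      exact ⟨g.trans (shiftIso χ), (shiftPerm_commutes χ).comp hg, by
        change (g (0, 0)).1 + 1 = _
        rw [hk, Nat.cast_succ]⟩
  have h2 : ∀ (k : ℕ) (y : ZMod 4 × ZMod n), ∃ g : torusGraph χ ≃g torusGraph χ,
      Commutes (stepA χ) (stepB χ) g ∧ g y = (y.1, y.2 + k) := by
    intro k y
    induction k with
    | zero => exact ⟨SimpleGraph.Iso.refl, fun x => ⟨rfl, rfl⟩, by simp⟩
    | succ k ih =>
      obtain ⟨g, hg, hk⟩ := ih
      exact ⟨g.trans (rotIso χ), (rotPerm_commutes χ).comp hg, by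
        change rotIso χ (g y) = _
        rw [hk, rotIso_apply, Nat.cast_succ, add_assoc]⟩
  obtain ⟨g, hg, hg1⟩ := h1 x.1.val
  obtain ⟨g', hg', hg1'⟩ := h2 (x.2 - (g (0, 0)).2).val (g (0, 0))
  refine ⟨g.trans g', hg'.comp hg, ?_⟩
  change g' (g (0, 0)) = x
  rw [hg1', hg1, ZMod.natCast_zmod_val, ZMod.natCast_zmod_val, add_sub_cancel]

theorem exists_commutes_apply_eq [NeZero n] (x y : ZMod 4 × ZMod n) :
    ∃ g : torusGraph χ ≃g torusGraph χ, Commutes (stepA χ) (stepB χ) g ∧ g x = y := by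
  obtain ⟨g, hg, rfl⟩ := exists_commutes_apply_zero χ x
  obtain ⟨g', hg', rfl⟩ := exists_commutes_apply_zero χ y
  exact ⟨g.symm.trans g', hg'.comp hg.symm, by simp⟩

end TorusGraph

section TorusGraph

variable {n q : ℕ} (χ : ZMod n ≃+* ZMod 48 × ZMod q)

/-! ### Degrees and connectedness -/

theorem torusGraph_adj_iff' (x y : ZMod 4 × ZMod n) : (torusGraph χ).Adj x y ↔
    y = stepA χ x ∨ y = stepB χ x ∨ y = (stepA χ)⁻¹ x ∨ y = (stepB χ)⁻¹ x := by
  rw [torusGraph_adj_iff, ← StepArc.inv (x := x), StepArc, StepArc, or_assoc]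

theorem level_stepA_inv (x : ZMod 4 × ZMod n) : level χ ((stepA χ)⁻¹ x) = level χ x - 1 := by
  rw [eq_sub_iff_add_eq, ← level_stepA, Equiv.Perm.apply_inv_apply]

theorem level_stepB_inv (x : ZMod 4 × ZMod n) : level χ ((stepB χ)⁻¹ x) = level χ x - 1 := by
  rw [eq_sub_iff_add_eq, ← level_stepB, Equiv.Perm.apply_inv_apply]

theorem ZMod.add_one_ne_sub_one_four : ∀ x : ZMod 4, x + 1 ≠ x - 1 := by decide

theorem ZMod.sub_one_ne_self_four : ∀ x : ZMod 4, x - 1 ≠ x := by decide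

theorem stepA_ne_stepA_inv (x : ZMod 4 × ZMod n) : stepA χ x ≠ (stepA χ)⁻¹ x := fun h =>
  ZMod.add_one_ne_sub_one_four _ (by rw [← level_stepA, ← level_stepA_inv, h])

theorem isQuartic_torusGraph : IsQuartic (torusGraph χ) := by
  intro x
  have hx : (torusGraph χ).neighborSet x =
      {stepA χ x, stepB χ x, (stepA χ)⁻¹ x, (stepB χ)⁻¹ x} := by
    ext y
    exact torusGraph_adj_iff' χ x y
  have h1 : stepA χ x ≠ (stepB χ)⁻¹ x := fun h =>
    ZMod.add_one_ne_sub_one_four _ (by rw [← level_stepA, ← level_stepB_inv, h])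
  have h2 : stepB χ x ≠ (stepA χ)⁻¹ x := fun h =>
    ZMod.add_one_ne_sub_one_four _ (by rw [← level_stepB, ← level_stepA_inv, h])
  have h3 : stepB χ x ≠ (stepB χ)⁻¹ x := fun h =>
    ZMod.add_one_ne_sub_one_four _ (by rw [← level_stepB, ← level_stepB_inv, h])
  have h4 : stepA χ x ≠ stepB χ x := fun h =>
    ZMod.add_one_ne_self_four x.1 (congrArg Prod.fst h).symm
  have h5 : (stepA χ)⁻¹ x ≠ (stepB χ)⁻¹ x := fun h =>
    ZMod.sub_one_ne_self_four x.1 (congrArg Prod.fst h).symm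
  rw [hx, Set.ncard_insert_of_notMem (by simp [h1, h4, stepA_ne_stepA_inv, -Equiv.Perm.coe_inv]),
    Set.ncard_insert_of_notMem (by simp [h2, h3, -Equiv.Perm.coe_inv]), Set.ncard_pair h5]

theorem connected_torusGraph [NeZero n] : (torusGraph χ).Connected := by
  have hA : ∀ x, (torusGraph χ).Adj x (stepA χ x) := fun x =>
    (torusGraph_adj_iff' χ _ _).2 (Or.inl rfl)
  have hB : ∀ x, (torusGraph χ).Adj x (stepB χ x) := fun x =>
    (torusGraph_adj_iff' χ _ _).2 (Or.inr (Or.inl rfl))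
  have h0 : ∀ k : ℕ, (torusGraph χ).Reachable (0, 0) (0, (k : ZMod n)) := by
    intro k
    induction k with
    | zero => simp
    | succ k ih =>
      refine ih.trans ?_
      have := (hA (0, (k : ZMod n))).reachable
      rw [stepA_apply] at this
      simpa using this
  have h1 : ∀ (k : ℕ) (j : ZMod n), (torusGraph χ).Reachable (0, 0) ((k : ZMod 4), j) := by
    intro k
    induction k with
    | zero =>
      intro j
      have := h0 j.val
      rw [ZMod.natCast_zmod_val] at this
      simpa using this
    | succ k ih =>
      intro j
      have := (hB ((k : ZMod 4), j - 4 * sgn χ * isLast n k)).reachable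
      rw [stepB_apply, sub_add_cancel] at this
      rw [Nat.cast_succ]
      exact (ih _).trans this
  have h2 : ∀ x, (torusGraph χ).Reachable (0, 0) x := fun x => by
    have := h1 x.1.val x.2
    rwa [ZMod.natCast_zmod_val] at this
  exact ⟨fun x y => (h2 x).symm.trans (h2 y)⟩

/-! ### The metacirculant structure -/

theorem rotIso_pow_apply (k : ℕ) (x : ZMod 4 × ZMod n) :
    (rotIso χ ^ k) x = (x.1, x.2 + k) := by
  induction k with
  | zero => simp
  | succ k ih =>
    rw [pow_succ', RelIso.mul_apply, ih, rotIso_apply, Nat.cast_succ, add_assoc]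

theorem rotIso_zpow_apply (k : ℤ) (x : ZMod 4 × ZMod n) :
    (rotIso χ ^ k) x = (x.1, x.2 + k) := by
  cases k with
  | ofNat k => simpa using rotIso_pow_apply χ k x
  | negSucc k =>
    rw [zpow_negSucc]
    apply (rotIso χ ^ (k + 1)).injective
    rw [← RelIso.mul_apply, mul_inv_cancel, RelIso.one_apply, rotIso_pow_apply]
    refine Prod.ext rfl ?_
    simp only [Int.cast_negSucc]
    ring

/-- The `i`-th layer. -/
def layer (n : ℕ) (i : ZMod 4) : Set (ZMod 4 × ZMod n) := {x | x.1 = i}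

theorem rotOrbit_rotIso [NeZero n] (x : ZMod 4 × ZMod n) :
    rotOrbit (rotIso χ) x = layer n x.1 := by
  ext y
  constructor
  · rintro ⟨k, rfl⟩
    beta_reduce
    rw [rotIso_zpow_apply]
    rfl
  · intro hy
    refine ⟨((y.2 - x.2).val : ℤ), ?_⟩
    beta_reduce
    rw [rotIso_zpow_apply]
    refine Prod.ext hy.symm ?_
    simp

theorem layer_injective : Function.Injective (layer n) := by
  intro i i' h
  have : ((i, 0) : ZMod 4 × ZMod n) ∈ layer n i' := by rw [← h]; rfl
  exact this

theorem rotOrbits_rotIso [NeZero n] : rotOrbits (rotIso χ) = Set.range (layer n) := by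
  ext s
  constructor
  · rintro ⟨x, rfl⟩
    exact ⟨x.1, (rotOrbit_rotIso χ x).symm⟩
  · rintro ⟨i, rfl⟩
    exact ⟨(i, 0), rotOrbit_rotIso χ (i, 0)⟩

theorem ncard_layer (i : ZMod 4) : (layer n i).ncard = n := by
  have : layer n i = Prod.mk i '' Set.univ := by
    ext ⟨i', j⟩
    simp [layer, eq_comm]
  rw [this, Set.ncard_image_of_injective _ (Prod.mk_right_injective i), Set.ncard_univ,
    Nat.card_zmod]

/-- The unit `r` of `ℤ_n`. -/
def multUnit : (ZMod n)ˣ where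
  val := 1 + nilp χ
  inv := 1 - nilp χ
  val_inv := by linear_combination -nil_mul_nil χ
  inv_val := by linear_combination -nil_mul_nil χ

theorem isWeakMetacirculantRel_torusGraph [NeZero n] (hn : 2 ≤ n) :
    IsWeakMetacirculantRel (torusGraph χ) 4 n (rotIso χ) (shiftIso χ) := by
  refine ⟨by norm_num, hn, ⟨?_, fun x => ?_⟩, ⟨multUnit χ, ?_⟩, layer n, layer_injective,
    (rotOrbits_rotIso χ).symm, fun i => ?_⟩
  · rw [rotOrbits_rotIso, ← Set.image_univ, Set.ncard_image_of_injective _ layer_injective,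
      Set.ncard_univ, Nat.card_zmod]
  · rw [rotOrbit_rotIso, ncard_layer]
  · rw [mul_inv_eq_iff_eq_mul]
    ext1 x
    rw [RelIso.mul_apply, RelIso.mul_apply, rotIso_pow_apply, ZMod.natCast_zmod_val]
    refine Prod.ext rfl ?_
    change (1 + nilp χ) * (x.2 + 1) + 4 * sgn χ * isLast n x.1 =
      (1 + nilp χ) * x.2 + 4 * sgn χ * isLast n x.1 + (1 + nilp χ)
    ring
  · ext x
    constructor
    · rintro ⟨y, hy, rfl⟩
      exact congrArg (· + 1) hy
    · intro hx
      refine ⟨(shiftIso χ).symm x, ?_, by simp⟩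
      have : x.1 - 1 = i := by rw [show x.1 = i + 1 from hx, add_sub_cancel_right]
      exact this

theorem neighborSet_inter_layer (x : ZMod 4 × ZMod n) :
    (torusGraph χ).neighborSet x ∩ layer n x.1 = {stepA χ x, (stepA χ)⁻¹ x} ∧
    (torusGraph χ).neighborSet x ∩ layer n (x.1 + 1) = {stepB χ x} ∧
    (torusGraph χ).neighborSet x ∩ layer n (x.1 - 1) = {(stepB χ)⁻¹ x} := by
  have h1 := ZMod.add_one_ne_sub_one_four x.1
  have h2 := ZMod.add_one_ne_self_four x.1
  have h3 := ZMod.sub_one_ne_self_four x.1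
  have a1 : (stepA χ x).1 = x.1 := rfl
  have a2 : ((stepA χ)⁻¹ x).1 = x.1 := rfl
  have a3 : (stepB χ x).1 = x.1 + 1 := rfl
  have a4 : ((stepB χ)⁻¹ x).1 = x.1 - 1 := rfl
  refine ⟨?_, ?_, ?_⟩ <;> ext y <;>
    simp only [Set.mem_inter_iff, SimpleGraph.mem_neighborSet, torusGraph_adj_iff', layer,
      Set.mem_ofPred_eq, Set.mem_insert_iff, Set.mem_singleton_iff]
  · constructor
    · rintro ⟨rfl | rfl | rfl | rfl, h⟩
      · exact Or.inl rfl
      · exact absurd (a3.symm.trans h) h2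
      · exact Or.inr rfl
      · exact absurd (a4.symm.trans h) h3
    · rintro (rfl | rfl)
      · exact ⟨Or.inl rfl, a1⟩
      · exact ⟨Or.inr (Or.inr (Or.inl rfl)), a2⟩
  · constructor
    · rintro ⟨rfl | rfl | rfl | rfl, h⟩
      · exact absurd (a1.symm.trans h).symm h2
      · rfl
      · exact absurd (a2.symm.trans h).symm h2
      · exact absurd (a4.symm.trans h).symm h1
    · rintro rfl
      exact ⟨Or.inr (Or.inl rfl), a3⟩
  · constructor
    · rintro ⟨rfl | rfl | rfl | rfl, h⟩
      · exact absurd (a1.symm.trans h).symm h3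
      · exact absurd (a3.symm.trans h) h1
      · exact absurd (a2.symm.trans h).symm h3
      · rfl
    · rintro rfl
      exact ⟨Or.inr (Or.inr (Or.inr rfl)), a4⟩

theorem isClassIIRel_torusGraph [NeZero n] : IsClassIIRel (torusGraph χ) (rotIso χ) := by
  have hnb : ∀ x y, (torusGraph χ).Adj x y → y.1 ≠ x.1 → y.1 = x.1 + 1 ∨ y.1 = x.1 - 1 := by
    intro x y h hne
    rcases (torusGraph_adj_iff' χ x y).1 h with rfl | rfl | rfl | rfl
    · exact absurd rfl hne
    · exact Or.inl rfl
    · exact absurd rfl hne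
    · exact Or.inr rfl
  refine ⟨fun x => ?_, ?_⟩
  · rw [rotOrbit_rotIso, (neighborSet_inter_layer χ x).1, Set.ncard_pair (stepA_ne_stepA_inv χ x)]
  · rw [rotOrbits_rotIso]
    rintro _ ⟨i, rfl⟩
    constructor
    · have : {O' ∈ Set.range (layer n) | O' ≠ layer n i ∧ ∃ u ∈ layer n i, ∃ w ∈ O',
          (torusGraph χ).Adj u w} = {layer n (i + 1), layer n (i - 1)} := by
        ext O
        constructor
        · rintro ⟨⟨i', rfl⟩, hne, u, rfl, w, rfl, huw⟩
          rcases hnb u w huw fun h => hne (by rw [h]) with h | h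
          · exact Or.inl (congrArg _ h)
          · exact Or.inr (congrArg _ h)
        · rintro (rfl | rfl)
          · refine ⟨⟨_, rfl⟩, fun h => ZMod.add_one_ne_self_four _ (layer_injective h),
              (i, 0), rfl, stepB χ (i, 0), rfl, ?_⟩
            exact (torusGraph_adj_iff' χ _ _).2 (Or.inr (Or.inl rfl))
          · refine ⟨⟨_, rfl⟩, fun h => ZMod.sub_one_ne_self_four _ (layer_injective h),
              (i, 0), rfl, (stepB χ)⁻¹ (i, 0), rfl, ?_⟩
            exact (torusGraph_adj_iff' χ _ _).2 (Or.inr (Or.inr (Or.inr rfl)))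
      rw [this, Set.ncard_pair fun h => ZMod.add_one_ne_sub_one_four _ (layer_injective h)]
    · rintro _ ⟨i', rfl⟩ hne ⟨u, hu, w, hw, huw⟩ x hx
      have hu' : u.1 = i := hu
      have hw' : w.1 = i' := hw
      obtain rfl : x.1 = i := hx
      rcases hnb u w huw fun h => hne (by rw [← hw', h, hu']) with h | h
      · rw [← hw', h, hu', (neighborSet_inter_layer χ x).2.1, Set.ncard_singleton]
      · rw [← hw', h, hu', (neighborSet_inter_layer χ x).2.2, Set.ncard_singleton]

theorem isWeakMetacirculantClassII_torusGraph [NeZero n] (hn : 2 ≤ n) :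
    IsWeakMetacirculantClassII (torusGraph χ) 4 n :=
  ⟨_, _, isWeakMetacirculantRel_torusGraph χ hn, isClassIIRel_torusGraph χ⟩

/-! ### Alternating cycles of the torus graphs -/

theorem inv_mul_apply (i : ZMod 4) (j : ZMod n) : ((stepB χ)⁻¹ * stepA χ) (i, j) =
    (i - 1, j + (1 + nilp χ * i.val) - 4 * sgn χ * isLast n (i - 1)) := rfl

theorem mul_inv_apply (i : ZMod 4) (j : ZMod n) : (stepA χ * (stepB χ)⁻¹) (i, j) =
    (i - 1, j - 4 * sgn χ * isLast n (i - 1) + (1 + nilp χ * (i - 1).val)) := rfl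

theorem ZMod.forall_four {P : ZMod 4 → Prop} (h0 : P 0) (h1 : P 1) (h2 : P 2) (h3 : P 3)
    (i : ZMod 4) : P i := by
  have : ∀ i : ZMod 4, i = 0 ∨ i = 1 ∨ i = 2 ∨ i = 3 := by decide
  rcases this i with rfl | rfl | rfl | rfl <;> assumption

theorem inv_mul_pow_four_apply (x : ZMod 4 × ZMod n) : (((stepB χ)⁻¹ * stepA χ) ^ (4 : ℤ)) x =
    (x.1, x.2 + (4 + 2 * nilp χ - 4 * sgn χ)) ∧
    ((stepA χ * (stepB χ)⁻¹) ^ (4 : ℤ)) x = (x.1, x.2 + (4 + 2 * nilp χ - 4 * sgn χ)) := by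
  obtain ⟨i, j⟩ := x
  have e : ∀ c : Equiv.Perm (ZMod 4 × ZMod n), ∀ x, (c ^ (4 : ℤ)) x = c (c (c (c x))) := by
    intro c x
    rw [zpow_ofNat, pow_succ, pow_succ, pow_succ, pow_one]
    rfl
  have s0 : (0 - 1 : ZMod 4) = 3 := by decide
  have s1 : (1 - 1 : ZMod 4) = 0 := by decide
  have s2 : (2 - 1 : ZMod 4) = 1 := by decide
  have s3 : (3 - 1 : ZMod 4) = 2 := by decide
  have v0 : ((0 : ZMod 4).val : ZMod n) = 0 := by simp
  have v1 : ((1 : ZMod 4).val : ZMod n) = 1 := by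
    rw [show (1 : ZMod 4).val = 1 from rfl, Nat.cast_one]
  have v2 : ((2 : ZMod 4).val : ZMod n) = 2 := by
    rw [show (2 : ZMod 4).val = 2 from rfl, Nat.cast_ofNat]
  have v3 : ((3 : ZMod 4).val : ZMod n) = 3 := by
    rw [show (3 : ZMod 4).val = 3 from rfl, Nat.cast_ofNat]
  have l0 : isLast n 0 = 0 := if_neg (by decide)
  have l1 : isLast n 1 = 0 := if_neg (by decide)
  have l2 : isLast n 2 = 0 := if_neg (by decide)
  have l3 : isLast n 3 = 1 := if_pos rfl
  rw [e, e]
  revert i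
  refine ZMod.forall_four ?_ ?_ ?_ ?_ <;>
  · simp only [inv_mul_apply, mul_inv_apply, s0, s1, s2, s3, v0, v1, v2, v3, l0, l1, l2, l3,
      Prod.mk.injEq, true_and]
    constructor <;> linear_combination four_mul_nil χ

/-- The reduction `ℤ_n → ℤ_16`. -/
def redSixteen : ZMod n →+* ZMod 16 :=
  ((ZMod.castHom (by norm_num : 16 ∣ 48) (ZMod 16)).comp (RingHom.fst _ _)).comp χ.toRingHom

theorem redSixteen_apply_symm (x : ZMod 48 × ZMod q) :
    redSixteen χ (χ.symm x) = ZMod.castHom (by norm_num : 16 ∣ 48) (ZMod 16) x.1 := by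
  simp [redSixteen]

theorem redSixteen_nil : redSixteen χ (nilp χ) = 12 := by
  rw [nilp, redSixteen_apply_symm, map_ofNat]

theorem redSixteen_sgn : redSixteen χ (sgn χ) = -1 := by
  rw [sgn, redSixteen_apply_symm, map_neg, map_one]

theorem redSixteen_isLast (i : ZMod 4) :
    redSixteen χ (isLast n i) = if i = 3 then 1 else 0 := by
  rw [isLast, apply_ite (redSixteen χ), map_one, map_zero]

/-- Correction terms that turn the reduction modulo `16` into an invariant of `b⁻¹ a`. -/
def corr (i : ZMod 4) : ZMod 16 := if i = 0 then 0 else if i = 1 then 13 else if i = 2 then 6 else 11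

/-- Correction terms that turn the reduction modulo `16` into an invariant of `a b⁻¹`. -/
def corr' (i : ZMod 4) : ZMod 16 := if i = 0 then 0 else if i = 1 then 1 else if i = 2 then 14 else 7

theorem invariant_inv_mul (k : ℤ) (x : ZMod 4 × ZMod n) :
    redSixteen χ ((((stepB χ)⁻¹ * stepA χ) ^ k) x).2 +
      corr ((((stepB χ)⁻¹ * stepA χ) ^ k) x).1 = redSixteen χ x.2 + corr x.1 := by
  have h := Equiv.Perm.apply_zpow_of_apply_add ((stepB χ)⁻¹ * stepA χ)
    (fun x => redSixteen χ x.2 + corr x.1) 0 ?_ k x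
  · simpa only [smul_zero, add_zero] using h
  rintro ⟨i, j⟩
  simp only [inv_mul_apply, map_sub, map_add, map_mul, map_one, map_natCast, map_ofNat,
    redSixteen_nil, redSixteen_sgn, redSixteen_isLast]
  have key : ∀ i : ZMod 4, (1 + 12 * (i.val : ZMod 16)) - 4 * -1 * (if i - 1 = 3 then 1 else 0) +
      corr (i - 1) = corr i := by decide
  linear_combination key i

theorem invariant_mul_inv (k : ℤ) (x : ZMod 4 × ZMod n) :
    redSixteen χ (((stepA χ * (stepB χ)⁻¹) ^ k) x).2 +
      corr' (((stepA χ * (stepB χ)⁻¹) ^ k) x).1 = redSixteen χ x.2 + corr' x.1 := by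
  have h := Equiv.Perm.apply_zpow_of_apply_add (stepA χ * (stepB χ)⁻¹)
    (fun x => redSixteen χ x.2 + corr' x.1) 0 ?_ k x
  · simpa only [smul_zero, add_zero] using h
  rintro ⟨i, j⟩
  simp only [mul_inv_apply, map_sub, map_add, map_mul, map_one, map_natCast, map_ofNat,
    redSixteen_nil, redSixteen_sgn, redSixteen_isLast]
  have key : ∀ i : ZMod 4, (1 + 12 * ((i - 1).val : ZMod 16)) -
      4 * -1 * (if i - 1 = 3 then 1 else 0) + corr' (i - 1) = corr' i := by decide
  linear_combination key i

theorem fst_inv_mul_zpow (k : ℤ) (x : ZMod 4 × ZMod n) :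
    ((((stepB χ)⁻¹ * stepA χ) ^ k) x).1 = x.1 - k := by
  rw [Equiv.Perm.apply_zpow_of_apply_add ((stepB χ)⁻¹ * stepA χ) Prod.fst (-1)
    (fun x => sub_eq_add_neg x.1 1), zsmul_eq_mul]
  ring

theorem fst_mul_inv_zpow (k : ℤ) (x : ZMod 4 × ZMod n) :
    (((stepA χ * (stepB χ)⁻¹) ^ k) x).1 = x.1 - k := by
  rw [Equiv.Perm.apply_zpow_of_apply_add (stepA χ * (stepB χ)⁻¹) Prod.fst (-1)
    (fun x => sub_eq_add_neg x.1 1), zsmul_eq_mul]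
  ring

theorem four_dvd_of_cast_eq_zero {k : ℤ} (x : ZMod 4) (h : x - k = x) : 4 ∣ k := by
  rw [sub_eq_self] at h
  exact_mod_cast (ZMod.intCast_zmod_eq_zero_iff_dvd k 4).1 h

/-- The permutation `(b⁻¹ a)⁴` moves second coordinates by the element `(32, 0)`, of order `3`. -/
theorem transl_eq : 4 + 2 * nilp χ - 4 * sgn χ = χ.symm (32, 0) := by
  rw [nilp, sgn, ← map_ofNat χ.symm 4, ← map_ofNat χ.symm 2, ← map_mul, ← map_mul, ← map_add,
    ← map_sub]
  exact congrArg χ.symm (Prod.ext (show (4 : ZMod 48) + 2 * 12 - 4 * -1 = 32 by decide)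
    (show (4 : ZMod q) + 2 * 0 - 4 * 1 = 0 by ring))

theorem inv_mul_zpow_four_mul_apply (m : ℤ) (x : ZMod 4 × ZMod n) :
    (((stepB χ)⁻¹ * stepA χ) ^ (4 * m)) x = (x.1, x.2 + χ.symm (m * 32, 0)) := by
  rw [zpow_mul]
  refine Prod.ext ?_ ?_
  · rw [Equiv.Perm.apply_zpow_of_apply_add _ Prod.fst 0
      (fun y => by rw [(inv_mul_pow_four_apply χ y).1, add_zero])]
    simp
  · rw [Equiv.Perm.apply_zpow_of_apply_add _ Prod.snd (χ.symm (32, 0))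
      (fun y => by rw [(inv_mul_pow_four_apply χ y).1, transl_eq]), zsmul_eq_mul,
      ← map_intCast χ.symm m, ← map_mul]
    congr 2
    exact Prod.ext rfl (mul_zero _)

theorem alternatingSystem_torusGraph :
    AlternatingSystem (torusGraph χ) (stepA χ) (stepB χ) where
  adj_iff := torusGraph_adj_iff χ
  grading := ⟨level χ, fun x => ⟨level_stepA χ x, level_stepB χ x⟩⟩
  period k z := by
    have key : ∀ m : ℤ, (((stepB χ)⁻¹ * stepA χ) ^ (4 * m)) z = z ↔ 3 ∣ m := by
      intro m
      have h32 : ((m * 32 : ℤ) : ZMod 48) = 0 ↔ 3 ∣ m := by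
        rw [ZMod.intCast_zmod_eq_zero_iff_dvd]
        push_cast
        omega
      rw [inv_mul_zpow_four_mul_apply, ← h32]
      push_cast
      constructor
      · intro h
        have h2 := congrArg Prod.snd h
        simp only [add_eq_left, EmbeddingLike.map_eq_zero_iff] at h2
        exact congrArg Prod.fst h2
      · intro h
        rw [h]
        have : ((0 : ZMod 48), (0 : ZMod q)) = 0 := rfl
        rw [this, map_zero, add_zero]
    constructor
    · intro h
      have h1 := congrArg Prod.fst h
      rw [fst_inv_mul_zpow] at h1
      obtain ⟨m, rfl⟩ := four_dvd_of_cast_eq_zero _ h1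
      have := (key m).1 h
      omega
    · rintro ⟨m, rfl⟩
      rw [show 12 * m = 4 * (3 * m) by ring, key]
      exact dvd_mul_right 3 m
  pow_four := by
    ext1 x
    rw [(inv_mul_pow_four_apply χ x).1, (inv_mul_pow_four_apply χ x).2]
  meet k l z h := by
    -- The two invariants differ by an injective function of the layer.
    have h1 := invariant_inv_mul χ k z
    have h2 := invariant_mul_inv χ l z
    rw [← h] at h2
    have key : ∀ i i' : ZMod 4, corr i - corr' i = corr i' - corr' i' → i = i' := by decide
    have h3 : ((((stepB χ)⁻¹ * stepA χ) ^ k) z).1 = z.1 := key _ _ (by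
      linear_combination h1 - h2)
    refine ⟨four_dvd_of_cast_eq_zero z.1 ?_, four_dvd_of_cast_eq_zero z.1 ?_⟩
    · rw [← fst_inv_mul_zpow χ, h3]
    · rw [← fst_mul_inv_zpow χ, ← h, h3]

end TorusGraph

/-! ### Counting walks -/

section WalkCount

variable {V : Type*} {G : SimpleGraph V}

open Classical in
/-- The number of walks of length `k` from `x` to `y`. -/
noncomputable def walkCount (G : SimpleGraph V) : ℕ → V → V → ℕ
  | 0, x, y => if x = y then 1 else 0
  | k + 1, x, y => ∑ᶠ z ∈ G.neighborSet x, walkCount G k z y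

theorem walkCount_zero (x y : V) [Decidable (x = y)] :
    walkCount G 0 x y = if x = y then 1 else 0 := by
  rw [walkCount]
  congr

theorem walkCount_map (g : G ≃g G) (k : ℕ) (x y : V) :
    walkCount G k (g x) (g y) = walkCount G k x y := by
  induction k generalizing x with
  | zero =>
    rw [walkCount, walkCount]
    classical exact if_congr g.injective.eq_iff rfl rfl
  | succ k ih =>
    have : G.neighborSet (g x) = g '' G.neighborSet x := by
      ext z
      constructor
      · intro hz
        refine ⟨g.symm z, ?_, by simp⟩
        rw [SimpleGraph.mem_neighborSet, ← g.map_adj_iff, g.apply_symm_apply]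
        exact hz
      · rintro ⟨w, hw, rfl⟩
        exact g.map_adj_iff.2 hw
    rw [walkCount, walkCount, this, finsum_mem_image g.injective.injOn]
    exact finsum_mem_congr rfl fun z _ => ih z

end WalkCount

section TorusGraph

variable {n q : ℕ} (χ : ZMod n ≃+* ZMod 48 × ZMod q)

theorem ne_of_level {x y z : ZMod 4 × ZMod n} (hx : level χ x = level χ z + 1)
    (hy : level χ y = level χ z - 1) : x ≠ y := by
  rintro rfl
  exact ZMod.add_one_ne_sub_one_four _ (hx.symm.trans hy)

theorem neighbors_ne (x : ZMod 4 × ZMod n) :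
    stepA χ x ≠ (stepA χ)⁻¹ x ∧ stepB χ x ≠ (stepB χ)⁻¹ x ∧ stepA χ x ≠ stepB χ x ∧
    stepA χ x ≠ (stepB χ)⁻¹ x ∧ (stepA χ)⁻¹ x ≠ stepB χ x ∧ (stepA χ)⁻¹ x ≠ (stepB χ)⁻¹ x :=
  ⟨ne_of_level χ (level_stepA χ x) (level_stepA_inv χ x),
    ne_of_level χ (level_stepB χ x) (level_stepB_inv χ x),
    fun h => ZMod.add_one_ne_self_four x.1 (congrArg Prod.fst h).symm,
    ne_of_level χ (level_stepA χ x) (level_stepB_inv χ x),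
    (ne_of_level χ (level_stepB χ x) (level_stepA_inv χ x)).symm,
    fun h => ZMod.sub_one_ne_self_four x.1 (congrArg Prod.fst h).symm⟩

theorem walkCount_succ (k : ℕ) (x y : ZMod 4 × ZMod n) :
    walkCount (torusGraph χ) (k + 1) x y =
      walkCount (torusGraph χ) k (stepA χ x) y + (walkCount (torusGraph χ) k ((stepA χ)⁻¹ x) y +
      (walkCount (torusGraph χ) k (stepB χ x) y +
        walkCount (torusGraph χ) k ((stepB χ)⁻¹ x) y)) := by
  obtain ⟨h1, h2, h3, h4, h5, h6⟩ := neighbors_ne χ x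
  have hx : (torusGraph χ).neighborSet x =
      {stepA χ x, (stepA χ)⁻¹ x, stepB χ x, (stepB χ)⁻¹ x} := by
    ext y
    rw [SimpleGraph.mem_neighborSet, torusGraph_adj_iff']
    simp only [Set.mem_insert_iff, Set.mem_singleton_iff]
    tauto
  rw [walkCount, hx, finsum_mem_insert _ (by simp [h1, h3, h4, -Equiv.Perm.coe_inv])
    (Set.toFinite _), finsum_mem_insert _ (by simp [h5, h6, -Equiv.Perm.coe_inv])
    (Set.toFinite _), finsum_mem_pair h2]

/-- An enumeration of the walks of length `k` that start in layer `i` at the second coordinate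
`(α, β)` and end in layer `i'` at a second coordinate whose first component is `α'` modulo `48`.
The components are kept as integers; each walk contributes the difference between the second
component at its end and `β'`, so that it ends at `(α', β')` if and only if `q` divides this
difference. -/
def closings (i' : ℕ) (α' β' : ℤ) : ℕ → ℕ → ℤ → ℤ → List ℤ
  | 0, i, α, β => if i = i' ∧ (α - α') % 48 = 0 then [β - β'] else []
  | k + 1, i, α, β =>
    closings i' α' β' k i (α + (1 + 12 * i)) (β + 1) ++
    (closings i' α' β' k i (α - (1 + 12 * i)) (β - 1) ++
    (closings i' α' β' k ((i + 1) % 4) (α + if i = 3 then 44 else 0) (β + if i = 3 then 4 else 0) ++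
    closings i' α' β' k ((i + 3) % 4) (α - if i = 0 then 44 else 0) (β - if i = 0 then 4 else 0)))

/-- The vertex in layer `i` whose second coordinate corresponds to `(α, β)`. -/
def point (i : ℕ) (α β : ℤ) : ZMod 4 × ZMod n := ((i : ZMod 4), χ.symm ((α : ZMod 48), (β : ZMod q)))

theorem one_add_nil_mul_val {i : ℕ} (hi : i < 4) :
    1 + nilp χ * ((i : ZMod 4).val : ZMod n) = χ.symm (((1 + 12 * i : ℤ) : ZMod 48), 1) := by
  rw [ZMod.val_natCast_of_lt hi, nilp, ← map_natCast χ.symm i, ← map_one χ.symm, ← map_mul,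
    ← map_add]
  refine congrArg χ.symm (Prod.ext ?_ ?_)
  · change (1 : ZMod 48) + 12 * (i : ZMod 48) = _
    push_cast
    ring
  · change (1 : ZMod q) + 0 * (i : ZMod q) = 1
    ring

theorem four_mul_sgn_mul_isLast {i : ℕ} (hi : i < 4) :
    4 * sgn χ * isLast n (i : ZMod 4) = χ.symm (((if i = 3 then 44 else 0 : ℤ) : ZMod 48),
      ((if i = 3 then 4 else 0 : ℤ) : ZMod q)) := by
  rw [← four_mul_sgn, isLast]
  have : (i : ZMod 4) = 3 ↔ i = 3 := by
    constructor
    · intro h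
      have := congrArg ZMod.val h
      rwa [ZMod.val_natCast_of_lt hi] at this
    · rintro rfl
      rfl
  by_cases h : i = 3
  · rw [if_pos (this.2 h), if_pos h, if_pos h]
    push_cast
    ring
  · rw [if_neg (this.not.2 h), if_neg h, if_neg h, mul_zero]
    push_cast
    exact (map_zero χ.symm).symm

theorem stepA_point {i : ℕ} (hi : i < 4) (α β : ℤ) :
    stepA χ (point χ i α β) = point χ i (α + (1 + 12 * i)) (β + 1) := by
  rw [point, stepA_apply, one_add_nil_mul_val χ hi, ← map_add]
  refine Prod.ext rfl (congrArg χ.symm (Prod.ext ?_ ?_))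
  · change (α : ZMod 48) + _ = _
    push_cast
    ring
  · change (β : ZMod q) + _ = _
    push_cast
    ring

theorem stepA_inv_point {i : ℕ} (hi : i < 4) (α β : ℤ) :
    (stepA χ)⁻¹ (point χ i α β) = point χ i (α - (1 + 12 * i)) (β - 1) := by
  rw [Equiv.Perm.inv_eq_iff_eq, stepA_point χ hi]
  simp

theorem stepB_point {i : ℕ} (hi : i < 4) (α β : ℤ) :
    stepB χ (point χ i α β) = point χ ((i + 1) % 4) (α + if i = 3 then 44 else 0)
      (β + if i = 3 then 4 else 0) := by
  rw [point, stepB_apply, four_mul_sgn_mul_isLast χ hi, ← map_add]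
  refine Prod.ext ?_ (congrArg χ.symm (Prod.ext ?_ ?_))
  · change (i : ZMod 4) + 1 = _
    rw [point, ZMod.natCast_mod, Nat.cast_succ]
  · change (α : ZMod 48) + _ = _
    push_cast
    ring
  · change (β : ZMod q) + _ = _
    push_cast
    ring

theorem stepB_inv_point {i : ℕ} (hi : i < 4) (α β : ℤ) :
    (stepB χ)⁻¹ (point χ i α β) = point χ ((i + 3) % 4) (α - if i = 0 then 44 else 0)
      (β - if i = 0 then 4 else 0) := by
  have h1 : ((i + 3) % 4 + 1) % 4 = i := by omega
  have h2 : (i + 3) % 4 = 3 ↔ i = 0 := by omega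
  rw [Equiv.Perm.inv_eq_iff_eq, stepB_point χ (Nat.mod_lt _ (by norm_num)), h1]
  simp only [h2, sub_add_cancel]

theorem point_eq_point_iff {i i' : ℕ} (hi : i < 4) (hi' : i' < 4) (α β α' β' : ℤ) :
    point χ i α β = point χ i' α' β' ↔
      (i = i' ∧ (α - α') % 48 = 0) ∧ (q : ℤ) ∣ β - β' := by
  rw [point, point, Prod.mk.injEq, χ.symm.injective.eq_iff, Prod.mk.injEq, and_assoc]
  refine and_congr ?_ (and_congr ?_ ?_)
  · constructor
    · intro h
      have := congrArg ZMod.val h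
      rwa [ZMod.val_natCast_of_lt hi, ZMod.val_natCast_of_lt hi'] at this
    · rintro rfl
      rfl
  · rw [eq_comm, ZMod.intCast_eq_intCast_iff_dvd_sub]
    exact ⟨fun h => Int.emod_eq_zero_of_dvd (by exact_mod_cast h),
      fun h => by exact_mod_cast Int.dvd_of_emod_eq_zero h⟩
  · rw [eq_comm, ZMod.intCast_eq_intCast_iff_dvd_sub]

/-- The list `closings` counts walks in `torusGraph χ` for all `χ` at once. -/
theorem walkCount_point {i' : ℕ} (hi' : i' < 4) (α' β' : ℤ) (k : ℕ) {i : ℕ} (hi : i < 4)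
    (α β : ℤ) : walkCount (torusGraph χ) k (point χ i α β) (point χ i' α' β') =
      (closings i' α' β' k i α β).countP fun d => decide ((q : ℤ) ∣ d) := by
  classical
  induction k generalizing i α β with
  | zero =>
    rw [walkCount_zero, closings, if_congr (point_eq_point_iff χ hi hi' α β α' β') rfl rfl]
    by_cases h1 : i = i' ∧ (α - α') % 48 = 0
    · by_cases h2 : (q : ℤ) ∣ β - β' <;> simp [h1, h2]
    · rw [if_neg h1, if_neg fun h => h1 h.1, List.countP_nil]
  | succ k ih =>
    have hlt : ∀ m, m % 4 < 4 := fun m => Nat.mod_lt m (by norm_num)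
    rw [walkCount_succ, stepA_point χ hi, stepA_inv_point χ hi, stepB_point χ hi,
      stepB_inv_point χ hi, ih hi, ih hi, ih (hlt _), ih (hlt _), closings, List.countP_append,
      List.countP_append, List.countP_append]

/-- The number of zeros in a list, its length, and the assertion that it has no entries
other than `0` and `±8`. -/
def summary (l : List ℤ) : ℕ × ℕ × Bool :=
  (l.countP (fun d => decide (d = 0)), l.length, l.all fun d => d = 0 || d = 8 || d = -8)

theorem countP_of_summary (hq : q = 1 ∨ ¬ q ∣ 8) {l : List ℤ} {u v : ℕ}
    (h : summary l = (u, v, true)) :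
    l.countP (fun d => decide ((q : ℤ) ∣ d)) = if q = 1 then v else u := by
  simp only [summary, Prod.mk.injEq, List.all_eq_true, Bool.or_eq_true, decide_eq_true_eq] at h
  obtain ⟨rfl, rfl, h⟩ := h
  rcases hq with rfl | hq
  · rw [if_pos rfl, List.countP_eq_length]
    simp
  · rw [if_neg (by rintro rfl; exact hq (one_dvd 8))]
    refine List.countP_congr fun d hd => ?_
    have h8 : ¬ (q : ℤ) ∣ 8 := by exact_mod_cast hq
    rcases h d hd with (rfl | rfl) | rfl
    · simp
    · simpa using h8
    · simpa using h8

/-- The pairs of neighbours of `u_0^0`, up to the exchange of the two kinds of steps: `(0, 1, 1)`,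
`(0, -1, -1)`, `(1, 0, 0)` and `(3, -44, -4)` are the neighbours along `a`, `a⁻¹`, `b` and `b⁻¹`. -/
theorem summary_closings :
    summary (closings 0 (-1) (-1) 6 0 1 1) = (101, 106, true) ∧
    summary (closings 0 1 1 6 0 (-1) (-1)) = (101, 106, true) ∧
    summary (closings 1 0 0 6 0 1 1) = (105, 105, true) ∧
    summary (closings 3 (-44) (-4) 6 0 (-1) (-1)) = (105, 105, true) ∧
    summary (closings 3 (-44) (-4) 6 0 1 1) = (105, 110, true) ∧
    summary (closings 1 0 0 6 0 (-1) (-1)) = (105, 110, true) := by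
  decide +kernel

/-- The number of walks of length `6` between the two neighbours of a vertex in a common line. -/
def straightCount (q : ℕ) : ℕ := if q = 1 then 106 else 101

theorem walkCount_zero_neighbors (hq : q = 1 ∨ ¬ q ∣ 8) :
    walkCount (torusGraph χ) 6 (stepA χ (0, 0)) ((stepA χ)⁻¹ (0, 0)) = straightCount q ∧
    walkCount (torusGraph χ) 6 ((stepA χ)⁻¹ (0, 0)) (stepA χ (0, 0)) = straightCount q ∧
    walkCount (torusGraph χ) 6 (stepA χ (0, 0)) (stepB χ (0, 0)) ≠ straightCount q ∧
    walkCount (torusGraph χ) 6 ((stepA χ)⁻¹ (0, 0)) ((stepB χ)⁻¹ (0, 0)) ≠ straightCount q ∧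
    walkCount (torusGraph χ) 6 (stepA χ (0, 0)) ((stepB χ)⁻¹ (0, 0)) ≠ straightCount q ∧
    walkCount (torusGraph χ) 6 ((stepA χ)⁻¹ (0, 0)) (stepB χ (0, 0)) ≠ straightCount q := by
  have h0 : ((0, 0) : ZMod 4 × ZMod n) = point χ 0 0 0 := by
    rw [point]
    push_cast
    exact Prod.ext rfl (map_zero χ.symm).symm
  have lt0 : 0 < 4 := by norm_num
  have lt1 : 1 < 4 := by norm_num
  have lt3 : 3 < 4 := by norm_num
  have hA : stepA χ (0, 0) = point χ 0 1 1 := by rw [h0, stepA_point χ lt0]; rfl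
  have hA' : (stepA χ)⁻¹ (0, 0) = point χ 0 (-1) (-1) := by
    rw [h0, stepA_inv_point χ lt0]; rfl
  have hB : stepB χ (0, 0) = point χ 1 0 0 := by rw [h0, stepB_point χ lt0]; rfl
  have hB' : (stepB χ)⁻¹ (0, 0) = point χ 3 (-44) (-4) := by
    rw [h0, stepB_inv_point χ lt0]; rfl
  obtain ⟨s1, s2, s3, s4, s5, s6⟩ := summary_closings
  rw [hA, hA', hB, hB', walkCount_point χ lt0 _ _ 6 lt0, walkCount_point χ lt0 _ _ 6 lt0,
    walkCount_point χ lt1 _ _ 6 lt0, walkCount_point χ lt3 _ _ 6 lt0,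
    walkCount_point χ lt3 _ _ 6 lt0, walkCount_point χ lt1 _ _ 6 lt0,
    countP_of_summary hq s1, countP_of_summary hq s2, countP_of_summary hq s3,
    countP_of_summary hq s4, countP_of_summary hq s5, countP_of_summary hq s6, straightCount]
  split_ifs <;> norm_num

/-- The two neighbours of a vertex in a line are told from the other pairs of neighbours by the
number of walks of length `6` between them. -/
theorem walkCount_neighbors [NeZero n] (hq : q = 1 ∨ ¬ q ∣ 8) (x : ZMod 4 × ZMod n) :
    walkCount (torusGraph χ) 6 (stepA χ x) ((stepA χ)⁻¹ x) = straightCount q ∧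
    walkCount (torusGraph χ) 6 ((stepA χ)⁻¹ x) (stepA χ x) = straightCount q ∧
    walkCount (torusGraph χ) 6 (stepA χ x) (stepB χ x) ≠ straightCount q ∧
    walkCount (torusGraph χ) 6 ((stepA χ)⁻¹ x) ((stepB χ)⁻¹ x) ≠ straightCount q ∧
    walkCount (torusGraph χ) 6 (stepA χ x) ((stepB χ)⁻¹ x) ≠ straightCount q ∧
    walkCount (torusGraph χ) 6 ((stepA χ)⁻¹ x) (stepB χ x) ≠ straightCount q := by
  obtain ⟨g, hg, rfl⟩ := exists_commutes_apply_zero χ x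
  have hA : ∀ y, (stepA χ)⁻¹ (g y) = g ((stepA χ)⁻¹ y) := fun y => by
    rw [Equiv.Perm.inv_eq_iff_eq, ← (hg _).1, Equiv.Perm.apply_inv_apply]
  have hB : ∀ y, (stepB χ)⁻¹ (g y) = g ((stepB χ)⁻¹ y) := fun y => by
    rw [Equiv.Perm.inv_eq_iff_eq, ← (hg _).2, Equiv.Perm.apply_inv_apply]
  simp only [hA, hB, ← (hg _).1, ← (hg _).2, walkCount_map]
  exact walkCount_zero_neighbors χ hq

theorem walkCount_neighbors' [NeZero n] (hq : q = 1 ∨ ¬ q ∣ 8) (x : ZMod 4 × ZMod n) :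
    walkCount (torusGraph χ) 6 (stepB χ x) ((stepB χ)⁻¹ x) = straightCount q ∧
    walkCount (torusGraph χ) 6 ((stepB χ)⁻¹ x) (stepB χ x) = straightCount q ∧
    walkCount (torusGraph χ) 6 (stepB χ x) (stepA χ x) ≠ straightCount q ∧
    walkCount (torusGraph χ) 6 ((stepB χ)⁻¹ x) ((stepA χ)⁻¹ x) ≠ straightCount q ∧
    walkCount (torusGraph χ) 6 (stepB χ x) ((stepA χ)⁻¹ x) ≠ straightCount q ∧
    walkCount (torusGraph χ) 6 ((stepB χ)⁻¹ x) (stepA χ x) ≠ straightCount q := by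
  have hg := flipIso_exchanges χ
  have hA : ∀ y, (stepA χ)⁻¹ (flipIso χ y) = flipIso χ ((stepB χ)⁻¹ y) := fun y => by
    rw [Equiv.Perm.inv_eq_iff_eq, ← (hg _).2, Equiv.Perm.apply_inv_apply]
  have hB : ∀ y, (stepB χ)⁻¹ (flipIso χ y) = flipIso χ ((stepA χ)⁻¹ y) := fun y => by
    rw [Equiv.Perm.inv_eq_iff_eq, ← (hg _).1, Equiv.Perm.apply_inv_apply]
  have := walkCount_neighbors χ hq (flipIso χ x)
  simpa only [hA, hB, ← (hg _).1, ← (hg _).2, walkCount_map] using this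

end TorusGraph

/-! ### Automorphisms respect the lines -/

/-- The map `g` carries the two neighbours of `v` along `a` to the two neighbours of `g v` along
`a` or to the two neighbours of `g v` along `b`. -/
def LineMap {V : Type*} (a b : Equiv.Perm V) (g : V → V) (v : V) : Prop :=
  (g (a v) = a (g v) ∧ g (a⁻¹ v) = a⁻¹ (g v)) ∨ (g (a v) = a⁻¹ (g v) ∧ g (a⁻¹ v) = a (g v)) ∨
  (g (a v) = b (g v) ∧ g (a⁻¹ v) = b⁻¹ (g v)) ∨ (g (a v) = b⁻¹ (g v) ∧ g (a⁻¹ v) = b (g v))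

/-- The map `g` carries the two neighbours of `v` along `a` to those of `g v` along `a`. -/
def KeepsLine {V : Type*} (a : Equiv.Perm V) (g : V → V) (v : V) : Prop :=
  (g (a v) = a (g v) ∧ g (a⁻¹ v) = a⁻¹ (g v)) ∨ (g (a v) = a⁻¹ (g v) ∧ g (a⁻¹ v) = a (g v))

section Lines

variable {V : Type*} {a b : Equiv.Perm V} {g : V → V}

/-- The four neighbours of every vertex along `a` and `b` are distinct. -/
def DistinctSteps (a b : Equiv.Perm V) : Prop := ∀ v, a v ≠ a⁻¹ v ∧ b v ≠ b⁻¹ v ∧ a v ≠ b v ∧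
  a v ≠ b⁻¹ v ∧ a⁻¹ v ≠ b v ∧ a⁻¹ v ≠ b⁻¹ v

theorem DistinctSteps.swap (h : DistinctSteps a b) : DistinctSteps b a := fun v =>
  ⟨(h v).2.1, (h v).1, (h v).2.2.1.symm, (h v).2.2.2.2.1.symm, (h v).2.2.2.1.symm,
    (h v).2.2.2.2.2.symm⟩

theorem KeepsLine.other (hne : DistinctSteps a b) (hg : Function.Injective g) {v : V}
    (hb : LineMap b a g v) (h : KeepsLine a g v) : KeepsLine b g v := by
  obtain ⟨-, -, h3, h4, h5, h6⟩ := hne v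
  have e : g (b v) ≠ a (g v) ∧ g (b v) ≠ a⁻¹ (g v) := by
    rcases h with ⟨h1, h2⟩ | ⟨h1, h2⟩ <;> rw [← h1, ← h2]
    · exact ⟨fun h => h3 (hg h).symm, fun h => h5 (hg h).symm⟩
    · exact ⟨fun h => h5 (hg h).symm, fun h => h3 (hg h).symm⟩
  rcases hb with h | h | h | h
  · exact Or.inl h
  · exact Or.inr h
  · exact absurd h.1 e.1
  · exact absurd h.1 e.2

theorem keepsLine_step_iff (hne : DistinctSteps a b) {v : V} (hv : LineMap a b g v)
    (hav : LineMap a b g (a v)) : KeepsLine a g (a v) ↔ KeepsLine a g v := by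
  obtain ⟨-, -, h3, h4, h5, h6⟩ := hne (g (a v))
  rw [LineMap, Equiv.Perm.inv_apply_apply] at hav
  constructor
  · intro h
    rw [KeepsLine, Equiv.Perm.inv_apply_apply] at h
    have hgv : g v = a (g (a v)) ∨ g v = a⁻¹ (g (a v)) :=
      h.elim (fun h => Or.inr h.2) fun h => Or.inl h.2
    rcases hv with h1 | h1 | h1 | h1
    · exact Or.inl h1
    · exact Or.inr h1
    · have h2 := Equiv.Perm.eq_inv_iff_eq.2 h1.1.symm
      rcases hgv with h | h
      · exact absurd (h.symm.trans h2) h4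
      · exact absurd (h.symm.trans h2) h6
    · have h2 := Equiv.Perm.eq_inv_iff_eq.1 h1.1
      rcases hgv with h | h
      · exact absurd (h.symm.trans h2.symm) h3
      · exact absurd (h.symm.trans h2.symm) h5
  · intro h
    have hgv : g v = a (g (a v)) ∨ g v = a⁻¹ (g (a v)) :=
      h.elim (fun h => Or.inr (Equiv.Perm.eq_inv_iff_eq.2 h.1.symm))
        fun h => Or.inl (Equiv.Perm.eq_inv_iff_eq.1 h.1).symm
    rw [KeepsLine, Equiv.Perm.inv_apply_apply]
    rcases hav with h1 | h1 | h1 | h1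
    · exact Or.inl h1
    · exact Or.inr h1
    · rcases hgv with h | h
      · exact absurd (h.symm.trans h1.2) h4
      · exact absurd (h.symm.trans h1.2) h6
    · rcases hgv with h | h
      · exact absurd (h.symm.trans h1.2) h3
      · exact absurd (h.symm.trans h1.2) h5

/-- A line that is kept is traversed in one direction. -/
theorem forward_step_iff (hne : DistinctSteps a b) {v : V} (hv : KeepsLine a g v)
    (hav : KeepsLine a g (a v)) : g (a (a v)) = a (g (a v)) ↔ g (a v) = a (g v) := by
  have h1 := (hne (g (a v))).1
  have h2 := (hne (g v)).1
  rw [KeepsLine, Equiv.Perm.inv_apply_apply] at hav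
  constructor
  · intro h
    rcases hv with hv | hv
    · exact hv.1
    · rcases hav with hav | hav
      · exact (Equiv.Perm.eq_inv_iff_eq.1 hav.2).symm
      · exact absurd (h.symm.trans hav.1) h1
  · intro h
    rcases hav with hav | hav
    · exact hav.1
    · have h3 := Equiv.Perm.eq_inv_iff_eq.2 h.symm
      exact absurd (hav.2.symm.trans h3) h1

end Lines

section TorusGraph

variable {n q : ℕ} (χ : ZMod n ≃+* ZMod 48 × ZMod q)

theorem distinctSteps : DistinctSteps (stepA χ) (stepB χ) := neighbors_ne χ

theorem lineMap_stepA [NeZero n] (hq : q = 1 ∨ ¬ q ∣ 8) (g : torusGraph χ ≃g torusGraph χ)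
    (v : ZMod 4 × ZMod n) : LineMap (stepA χ) (stepB χ) g v := by
  have hadj := fun y => torusGraph_adj_iff' χ v y
  have h1 := (torusGraph_adj_iff' χ (g v) _).1 (g.map_adj_iff.2 ((hadj _).2 (Or.inl rfl)))
  have h2 := (torusGraph_adj_iff' χ (g v) _).1
    (g.map_adj_iff.2 ((hadj _).2 (Or.inr (Or.inr (Or.inl rfl)))))
  have hc := (walkCount_neighbors χ hq v).1
  rw [← walkCount_map g] at hc
  have hne : g (stepA χ v) ≠ g ((stepA χ)⁻¹ v) := fun h =>
    (neighbors_ne χ v).1 (g.injective h)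
  obtain ⟨-, -, a1, a2, a3, a4⟩ := walkCount_neighbors χ hq (g v)
  obtain ⟨-, -, b1, b2, b3, b4⟩ := walkCount_neighbors' χ hq (g v)
  rw [LineMap]
  rcases h1 with h1 | h1 | h1 | h1 <;> rcases h2 with h2 | h2 | h2 | h2 <;>
    rw [h1, h2] at hc hne <;> first
      | exact absurd rfl hne
      | exact absurd hc (by assumption)
      | (rw [h1, h2]; simp only [true_or, or_true, and_self])

theorem lineMap_stepB [NeZero n] (hq : q = 1 ∨ ¬ q ∣ 8) (g : torusGraph χ ≃g torusGraph χ)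
    (v : ZMod 4 × ZMod n) : LineMap (stepB χ) (stepA χ) g v := by
  have hadj := fun y => torusGraph_adj_iff' χ v y
  have h1 := (torusGraph_adj_iff' χ (g v) _).1
    (g.map_adj_iff.2 ((hadj _).2 (Or.inr (Or.inl rfl))))
  have h2 := (torusGraph_adj_iff' χ (g v) _).1
    (g.map_adj_iff.2 ((hadj _).2 (Or.inr (Or.inr (Or.inr rfl)))))
  have hc := (walkCount_neighbors' χ hq v).1
  rw [← walkCount_map g] at hc
  have hne : g (stepB χ v) ≠ g ((stepB χ)⁻¹ v) := fun h =>
    (neighbors_ne χ v).2.1 (g.injective h)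
  obtain ⟨-, -, a1, a2, a3, a4⟩ := walkCount_neighbors χ hq (g v)
  obtain ⟨-, -, b1, b2, b3, b4⟩ := walkCount_neighbors' χ hq (g v)
  rw [LineMap]
  rcases h1 with h1 | h1 | h1 | h1 <;> rcases h2 with h2 | h2 | h2 | h2 <;>
    rw [h1, h2] at hc hne <;> first
      | exact absurd rfl hne
      | exact absurd hc (by assumption)
      | (rw [h1, h2]; simp only [true_or, or_true, and_self])

theorem iff_of_step_iff [NeZero n] {P : ZMod 4 × ZMod n → Prop}
    (hA : ∀ x, P (stepA χ x) ↔ P x) (hB : ∀ x, P (stepB χ x) ↔ P x) (x y : ZMod 4 × ZMod n) :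
    P x ↔ P y := by
  obtain ⟨w⟩ := (connected_torusGraph χ).preconnected x y
  induction w with
  | nil => rfl
  | cons h _ ih =>
    rw [← ih]
    rcases (torusGraph_adj_iff χ _ _).1 h with (rfl | rfl) | (rfl | rfl)
    · exact (hA _).symm
    · exact (hB _).symm
    · exact hA _
    · exact hB _

/-- An automorphism that carries one line of `stepA` to a line of `stepA` respects both kinds of
lines everywhere. -/
theorem keepsLine_of_keepsLine [NeZero n] (hq : q = 1 ∨ ¬ q ∣ 8)
    (g : torusGraph χ ≃g torusGraph χ) {v : ZMod 4 × ZMod n} (h : KeepsLine (stepA χ) g v)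
    (x : ZMod 4 × ZMod n) : KeepsLine (stepA χ) g x ∧ KeepsLine (stepB χ) g x := by
  have hlA := lineMap_stepA χ hq g
  have hlB := lineMap_stepB χ hq g
  have hne := distinctSteps χ
  have hAB : ∀ x, KeepsLine (stepA χ) g x ↔ KeepsLine (stepB χ) g x := fun x =>
    ⟨fun h => h.other hne g.injective (hlB x), fun h => h.other hne.swap g.injective (hlA x)⟩
  have hx : KeepsLine (stepA χ) g x :=
    (iff_of_step_iff χ (fun x => keepsLine_step_iff hne (hlA x) (hlA _))
      (fun x => by rw [hAB, hAB, keepsLine_step_iff hne.swap (hlB x) (hlB _)]) v x).1 h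
  exact ⟨hx, (hAB x).1 hx⟩

/-! ### Automorphisms preserve the orientation -/

theorem stepA_pow_apply (k : ℕ) (x : ZMod 4 × ZMod n) :
    (stepA χ ^ k) x = (x.1, x.2 + k * (1 + nilp χ * x.1.val)) := by
  induction k with
  | zero => simp
  | succ k ih =>
    rw [pow_succ', Equiv.Perm.mul_apply, ih, stepA_apply]
    refine Prod.ext rfl ?_
    simp only
    push_cast
    ring

theorem exists_stepA_pow_apply [NeZero n] {x y : ZMod 4 × ZMod n} (h : x.1 = y.1) :
    ∃ k : ℕ, (stepA χ ^ k) x = y := by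
  refine ⟨((y.2 - x.2) * (1 - nilp χ * x.1.val)).val, ?_⟩
  rw [stepA_pow_apply, ZMod.natCast_zmod_val]
  refine Prod.ext h ?_
  simp only
  linear_combination -(y.2 - x.2) * (x.1.val : ZMod n) ^ 2 * nil_mul_nil χ

/-- An automorphism that respects the lines permutes the layers, and it traverses all lines along
`stepB` in the same direction. -/
theorem forward_stepB_iff [NeZero n] {g : torusGraph χ ≃g torusGraph χ}
    (hA : ∀ x, KeepsLine (stepA χ) g x) (hB : ∀ x, KeepsLine (stepB χ) g x)
    (x y : ZMod 4 × ZMod n) :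
    g (stepB χ x) = stepB χ (g x) ↔ g (stepB χ y) = stepB χ (g y) := by
  have h1 : ∀ x, (g (stepA χ x)).1 = (g x).1 := fun x => by
    rcases hA x with h | h <;> rw [h.1] <;> rfl
  have h2 : ∀ x y : ZMod 4 × ZMod n, x.1 = y.1 → (g x).1 = (g y).1 := by
    intro x y hxy
    obtain ⟨k, rfl⟩ := exists_stepA_pow_apply χ hxy
    clear hxy
    induction k with
    | zero => rfl
    | succ k ih => rw [pow_succ', Equiv.Perm.mul_apply, h1, ih]
  have h3 : ∀ x, g (stepB χ x) = stepB χ (g x) ↔ (g (stepB χ x)).1 = (g x).1 + 1 := by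
    intro x
    constructor
    · intro h
      rw [h]
      rfl
    · intro h
      rcases hB x with h' | h'
      · exact h'.1
      · rw [h'.1] at h
        exact absurd h.symm (ZMod.add_one_ne_sub_one_four _)
  refine iff_of_step_iff χ (P := fun x => g (stepB χ x) = stepB χ (g x)) (fun x => ?_)
    (fun x => forward_step_iff (distinctSteps χ).swap (hB x) (hB _)) x y
  rw [h3, h3, h1, h2 (stepB χ (stepA χ x)) (stepB χ x) rfl]

theorem forward_or_backward_stepB [NeZero n] {g : torusGraph χ ≃g torusGraph χ}
    (hA : ∀ x, KeepsLine (stepA χ) g x) (hB : ∀ x, KeepsLine (stepB χ) g x) :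
    (∀ x, g (stepB χ x) = stepB χ (g x)) ∨ ∀ x, g (stepB χ x) = (stepB χ)⁻¹ (g x) := by
  by_cases h : g (stepB χ 0) = stepB χ (g 0)
  · exact Or.inl fun x => (forward_stepB_iff χ hA hB x 0).2 h
  · refine Or.inr fun x => ?_
    rcases hB x with h' | h'
    · exact absurd ((forward_stepB_iff χ hA hB x 0).1 h'.1) h
    · exact h'.1

theorem flipIso_stepA (x : ZMod 4 × ZMod n) :
    flipIso χ (stepA χ x) = stepB χ (flipIso χ x) ∧
    flipIso χ ((stepA χ)⁻¹ x) = (stepB χ)⁻¹ (flipIso χ x) :=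
  ⟨(flipIso_exchanges χ x).1, by
    rw [Equiv.Perm.eq_inv_iff_eq, ← (flipIso_exchanges χ _).1, Equiv.Perm.apply_inv_apply]⟩

theorem flipIso_stepB (x : ZMod 4 × ZMod n) :
    flipIso χ (stepB χ x) = stepA χ (flipIso χ x) ∧
    flipIso χ ((stepB χ)⁻¹ x) = (stepA χ)⁻¹ (flipIso χ x) :=
  ⟨(flipIso_exchanges χ x).2, by
    rw [Equiv.Perm.eq_inv_iff_eq, ← (flipIso_exchanges χ _).2, Equiv.Perm.apply_inv_apply]⟩

/-- The lines along `stepA` are dealt with by conjugating with the involution `flipIso`. -/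
theorem forward_or_backward_stepA [NeZero n] {g : torusGraph χ ≃g torusGraph χ}
    (hA : ∀ x, KeepsLine (stepA χ) g x) (hB : ∀ x, KeepsLine (stepB χ) g x) :
    (∀ x, g (stepA χ x) = stepA χ (g x)) ∨ ∀ x, g (stepA χ x) = (stepA χ)⁻¹ (g x) := by
  have e : ∀ x, ((flipIso χ).trans (g.trans (flipIso χ))) x = flipIso χ (g (flipIso χ x)) :=
    fun x => rfl
  have h := forward_or_backward_stepB χ (g := (flipIso χ).trans (g.trans (flipIso χ))) ?_ ?_
  · simp only [e, flipIso_stepB] at h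
    refine h.imp (fun h x => ?_) fun h x => ?_
    · have hx := congrArg (flipIso χ) (h (flipIso χ x))
      simpa only [flipIso_stepB, flipIso_flipIso] using hx
    · have hx := congrArg (flipIso χ) (h (flipIso χ x))
      simpa only [flipIso_stepB, flipIso_flipIso] using hx
  · intro x
    simp only [KeepsLine, e, flipIso_stepA]
    refine (hB (flipIso χ x)).imp (fun h => ?_) fun h => ?_ <;>
      simp only [h.1, h.2, flipIso_stepB, and_self]
  · intro x
    simp only [KeepsLine, e, flipIso_stepB]
    refine (hA (flipIso χ x)).imp (fun h => ?_) fun h => ?_ <;>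
      simp only [h.1, h.2, flipIso_stepA, and_self]

theorem two_mul_nil_ne_zero : 2 * nilp χ ≠ 0 := by
  rw [nilp, ← map_ofNat χ.symm 2, ← map_mul, Ne, EmbeddingLike.map_eq_zero_iff]
  intro h
  exact absurd (show (2 : ZMod 48) * 12 = 0 from congrArg Prod.fst h) (by decide)

theorem eight_mul_sgn_ne_zero : 8 * sgn χ ≠ 0 := by
  rw [sgn, ← map_ofNat χ.symm 8, ← map_mul, Ne, EmbeddingLike.map_eq_zero_iff]
  intro h
  exact absurd (show (8 : ZMod 48) * -1 = 0 from congrArg Prod.fst h) (by decide)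

theorem apply_pow_eq {V : Type*} {g : V → V} {c d : Equiv.Perm V}
    (h : ∀ x, g (c x) = d (g x)) (k : ℕ) (x : V) : g ((c ^ k) x) = (d ^ k) (g x) := by
  induction k with
  | zero => rfl
  | succ k ih => rw [pow_succ', pow_succ', Equiv.Perm.mul_apply, Equiv.Perm.mul_apply, h, ih]

theorem commutes_of_keepsLine [NeZero n] (g : torusGraph χ ≃g torusGraph χ)
    (hA : ∀ x, KeepsLine (stepA χ) g x) (hB : ∀ x, KeepsLine (stepB χ) g x) :
    Commutes (stepA χ) (stepB χ) g := by
  -- Composing with an automorphism that commutes with both steps, one may assume that `g`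
  -- fixes `u_0^0`; then the images of layers `0` and `1` are explicit.
  obtain ⟨s, hs, hs0⟩ := exists_commutes_apply_eq χ (g (0, 0)) (0, 0)
  have hsA : ∀ x, s ((stepA χ)⁻¹ x) = (stepA χ)⁻¹ (s x) := fun x => by
    rw [Equiv.Perm.eq_inv_iff_eq, ← (hs _).1, Equiv.Perm.apply_inv_apply]
  have hsB : ∀ x, s ((stepB χ)⁻¹ x) = (stepB χ)⁻¹ (s x) := fun x => by
    rw [Equiv.Perm.eq_inv_iff_eq, ← (hs _).2, Equiv.Perm.apply_inv_apply]
  have v0 : ((0 : ZMod 4).val : ZMod n) = 0 := by simp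
  have v1 : ((1 : ZMod 4).val : ZMod n) = 1 := by
    rw [show (1 : ZMod 4).val = 1 from rfl, Nat.cast_one]
  have v3 : ((3 : ZMod 4).val : ZMod n) = 3 := by
    rw [show (3 : ZMod 4).val = 3 from rfl, Nat.cast_ofNat]
  have l0 : isLast n 0 = 0 := if_neg (by decide)
  have l1 : isLast n 1 = 0 := if_neg (by decide)
  have l2 : isLast n 2 = 0 := if_neg (by decide)
  have l3 : isLast n 3 = 1 := if_pos rfl
  have hsgA := forward_or_backward_stepA χ hA hB
  -- The second coordinates of the images of the vertices of layer `0`.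
  obtain ⟨ε, hε, hgA, hg0⟩ : ∃ ε : ZMod n, (ε = 1 ∨ ε = -1) ∧
      (∀ x, s (g (stepA χ x)) = ((s (g x)).1, (s (g x)).2 + ε * (1 + nilp χ * (s (g x)).1.val))) ∧
      ((∀ x, g (stepA χ x) = stepA χ (g x)) ∨ ε = -1) := by
    rcases hsgA with h | h
    · refine ⟨1, Or.inl rfl, fun x => ?_, Or.inl h⟩
      rw [h, (hs _).1, one_mul]
      rfl
    · refine ⟨-1, Or.inr rfl, fun x => ?_, Or.inr rfl⟩
      rw [h, hsA, neg_one_mul, ← sub_eq_add_neg]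
      rfl
  have hrow : ∀ j : ZMod n, s (g (0, j)) = (0, ε * j) := by
    have : ∀ k : ℕ, s (g (0, (k : ZMod n))) = (0, ε * k) := by
      intro k
      induction k with
      | zero => simpa using hs0
      | succ k ih =>
        have e1 : ((0, ((k + 1 : ℕ) : ZMod n)) : ZMod 4 × ZMod n) = stepA χ (0, (k : ZMod n)) := by
          rw [stepA_apply, v0, Nat.cast_succ, mul_zero, add_zero]
        rw [e1, hgA, ih]
        refine Prod.ext rfl ?_
        simp only [v0]
        push_cast
        ring
    intro j
    have := this j.val
    rwa [ZMod.natCast_zmod_val] at this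
  rcases forward_or_backward_stepB χ hA hB with hgB | hgB
  · rcases hg0 with h | rfl
    · exact fun x => ⟨h x, hgB x⟩
    · -- Four steps `b` lead from `u_0^0` to `u_0^t`, and `-t ≠ t`.
      exfalso
      have e : ∀ j, stepB χ (stepB χ (stepB χ (stepB χ (0, j)))) = (0, j + 4 * sgn χ) := by
        intro j
        simp only [stepB_apply]
        rw [show (0 : ZMod 4) + 1 = 1 by decide, show (1 : ZMod 4) + 1 = 2 by decide,
          show (2 : ZMod 4) + 1 = 3 by decide, show (3 : ZMod 4) + 1 = 0 by decide, l0, l1, l2, l3]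
        simp
      have h1 := hrow (4 * sgn χ)
      have h2 := e 0
      rw [zero_add] at h2
      rw [← h2, hgB, hgB, hgB, hgB, (hs _).2, (hs _).2, (hs _).2, (hs _).2, hs0, e] at h1
      have h3 := congrArg Prod.snd h1
      simp only at h3
      exact eight_mul_sgn_ne_zero χ (by linear_combination h3)
  · -- A step `a` in layer `1` has the length of a step in layer `3` up to sign, but `r ≠ r³`.
    exfalso
    have e : ∀ j, stepB χ (0, j) = (1, j) := fun j => by
      rw [stepB_apply, l0, mul_zero, add_zero, zero_add]
    have e' : ∀ j, (stepB χ)⁻¹ (0, j) = (3, j - 4 * sgn χ) := fun j => by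
      rw [stepB_inv_apply, show (0 : ZMod 4) - 1 = 3 by decide, l3, mul_one]
    have h1 : ∀ j, s (g (1, j)) = (3, ε * j - 4 * sgn χ) := fun j => by
      rw [← e, hgB, hsB, hrow, e']
    have h2 := hgA (1, 0)
    rw [stepA_apply, h1, h1, v1, v3] at h2
    have h3 := congrArg Prod.snd h2
    simp only at h3
    have h4 : ε * (2 * nilp χ) = 0 := by linear_combination -h3
    rcases hε with rfl | rfl
    · exact two_mul_nil_ne_zero χ (by simpa using h4)
    · exact two_mul_nil_ne_zero χ (by simpa using h4)

theorem commutes_or_exchanges [NeZero n] (hq : q = 1 ∨ ¬ q ∣ 8)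
    (g : torusGraph χ ≃g torusGraph χ) :
    Commutes (stepA χ) (stepB χ) g ∨ Exchanges (stepA χ) (stepB χ) g := by
  have key : ∀ g : torusGraph χ ≃g torusGraph χ, KeepsLine (stepA χ) g 0 →
      Commutes (stepA χ) (stepB χ) g := fun g h =>
    commutes_of_keepsLine χ g (fun x => (keepsLine_of_keepsLine χ hq g h x).1)
      fun x => (keepsLine_of_keepsLine χ hq g h x).2
  rcases lineMap_stepA χ hq g 0 with h | h | h
  · exact Or.inl (key g (Or.inl h))
  · exact Or.inl (key g (Or.inr h))
  · right
    have e : ∀ x, (g.trans (flipIso χ)) x = flipIso χ (g x) := fun x => rfl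
    have h' := key (g.trans (flipIso χ)) (by
      simp only [KeepsLine, e]
      refine h.imp (fun h => ?_) fun h => ?_ <;>
        simp only [h.1, h.2, flipIso_stepB, and_self])
    intro x
    have h1 : flipIso χ (g (stepA χ x)) = stepA χ (flipIso χ (g x)) := (h' x).1
    have h2 : flipIso χ (g (stepB χ x)) = stepB χ (flipIso χ (g x)) := (h' x).2
    rw [← (flipIso_exchanges χ _).2] at h1
    rw [← (flipIso_exchanges χ _).1] at h2
    exact ⟨(flipIso χ).injective h1, (flipIso χ).injective h2⟩

theorem rigidSystem_torusGraph [NeZero n] (hq : q = 1 ∨ ¬ q ∣ 8) :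
    RigidSystem (torusGraph χ) (stepA χ) (stepB χ) where
  adj_iff := torusGraph_adj_iff χ
  asymm := stepArc_asymm χ
  transitive := exists_commutes_apply_eq χ
  exchange := ⟨flipIso χ, flipIso_exchanges χ⟩
  rigid := commutes_or_exchanges χ hq

theorem isHalfArcTransitive_torusGraph [NeZero n] (hq : q = 1 ∨ ¬ q ∣ 8) :
    IsHalfArcTransitive (torusGraph χ) :=
  (rigidSystem_torusGraph χ hq).isHalfArcTransitive

theorem hasRadius_and_hasAttachmentNumber_torusGraph [NeZero n] (hq : q = 1 ∨ ¬ q ∣ 8) :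
    HasRadius (torusGraph χ) 12 ∧ HasAttachmentNumber (torusGraph χ) 3 :=
  (alternatingSystem_torusGraph χ).hasRadius_and_hasAttachmentNumber fun _ hD =>
    (rigidSystem_torusGraph χ hq).eq_stepArc_of_isNaturalOrientation hD

end TorusGraph

/-! ### Invariance under isomorphisms -/

section Transport

variable {V W : Type*} {G : SimpleGraph V} {H : SimpleGraph W}

/-- Conjugation by an isomorphism of graphs, as an isomorphism of automorphism groups. -/
def autCongr (e : G ≃g H) : (G ≃g G) ≃* (H ≃g H) where
  toFun g := e.symm.trans (g.trans e)
  invFun g := e.trans (g.trans e.symm)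
  left_inv g := by ext x; simp
  right_inv g := by ext x; simp
  map_mul' g h := by ext x; simp [RelIso.mul_apply]

theorem autCongr_apply (e : G ≃g H) (g : G ≃g G) (x : V) : autCongr e g (e x) = e (g x) := by
  simp [autCongr]

theorem neighborSet_iso (e : G ≃g H) (x : V) : H.neighborSet (e x) = e '' G.neighborSet x := by
  ext z
  obtain ⟨z, rfl⟩ := e.surjective z
  rw [e.injective.mem_set_image, SimpleGraph.mem_neighborSet, SimpleGraph.mem_neighborSet,
    e.map_adj_iff]

theorem IsQuartic.of_iso (e : G ≃g H) (h : IsQuartic G) : IsQuartic H := by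
  intro y
  obtain ⟨x, rfl⟩ := e.surjective y
  rw [neighborSet_iso, Set.ncard_image_of_injective _ e.injective, h x]

theorem IsHalfArcTransitive.of_iso (e : G ≃g H) (h : IsHalfArcTransitive G) :
    IsHalfArcTransitive H := by
  refine ⟨fun u v => ?_, fun s hs t ht => ?_, fun ha => h.2.2 fun a b c d hab hcd => ?_⟩
  · obtain ⟨u, rfl⟩ := e.surjective u
    obtain ⟨v, rfl⟩ := e.surjective v
    obtain ⟨g, rfl⟩ := h.1 u v
    exact ⟨autCongr e g, autCongr_apply e g u⟩
  · have key : ∀ s ∈ H.edgeSet, ∃ s' ∈ G.edgeSet, s = Sym2.map e s' := by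
      intro s hs
      induction s with
      | _ x y =>
      obtain ⟨x, rfl⟩ := e.surjective x
      obtain ⟨y, rfl⟩ := e.surjective y
      exact ⟨s(x, y), e.map_adj_iff.1 hs, rfl⟩
    obtain ⟨s', hs', rfl⟩ := key s hs
    obtain ⟨t', ht', rfl⟩ := key t ht
    obtain ⟨g, rfl⟩ := h.2.1 s' hs' t' ht'
    refine ⟨autCongr e g, ?_⟩
    rw [Sym2.map_map, Sym2.map_map]
    congr 1
    funext x
    exact autCongr_apply e g x
  · obtain ⟨g, h1, h2⟩ := ha _ _ _ _ (e.map_adj_iff.2 hab) (e.map_adj_iff.2 hcd)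
    refine ⟨(autCongr e).symm g, e.injective ?_, e.injective ?_⟩
    · rw [← autCongr_apply, MulEquiv.apply_symm_apply, h1]
    · rw [← autCongr_apply, MulEquiv.apply_symm_apply, h2]

theorem rotOrbit_autCongr (e : G ≃g H) (ρ : G ≃g G) (x : V) :
    rotOrbit (autCongr e ρ) (e x) = e '' rotOrbit ρ x := by
  ext y
  simp only [rotOrbit, Set.mem_range, Set.mem_image, ← map_zpow, autCongr_apply,
    exists_exists_eq_and]

theorem rotOrbits_autCongr (e : G ≃g H) (ρ : G ≃g G) :
    rotOrbits (autCongr e ρ) = Set.image e '' rotOrbits ρ := by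
  rw [rotOrbits, rotOrbits, ← Set.range_comp, ← e.surjective.range_comp]
  congr 1
  funext x
  exact rotOrbit_autCongr e ρ x

theorem IsWeakMetacirculantClassII.of_iso (e : G ≃g H) {m n : ℕ}
    (h : IsWeakMetacirculantClassII G m n) : IsWeakMetacirculantClassII H m n := by
  obtain ⟨ρ, σ, ⟨hm, hn, ⟨h1, h2⟩, ⟨r, hr⟩, X, hX, hXr, hXσ⟩, h3, h4⟩ := h
  have he : Function.Injective (Set.image e) := e.injective.image_injective
  refine ⟨autCongr e ρ, autCongr e σ, ⟨hm, hn, ⟨?_, fun y => ?_⟩, ⟨r, ?_⟩, fun i => e '' X i,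
    he.comp hX, ?_, fun i => ?_⟩, fun y => ?_, ?_⟩
  · rw [rotOrbits_autCongr, Set.ncard_image_of_injective _ he, h1]
  · obtain ⟨x, rfl⟩ := e.surjective y
    rw [rotOrbit_autCongr, Set.ncard_image_of_injective _ e.injective, h2]
  · rw [← map_mul, ← map_inv, ← map_mul, hr, map_pow]
  · rw [rotOrbits_autCongr, ← hXr, ← Set.range_comp]
    rfl
  · beta_reduce
    rw [← hXσ, Set.image_image, Set.image_image]
    simp only [autCongr_apply]
  · obtain ⟨x, rfl⟩ := e.surjective y
    rw [neighborSet_iso, rotOrbit_autCongr, ← Set.image_inter e.injective,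
      Set.ncard_image_of_injective _ e.injective, h3]
  · rw [rotOrbits_autCongr]
    rintro _ ⟨O, hO, rfl⟩
    obtain ⟨h5, h6⟩ := h4 O hO
    have hadj : ∀ O', (∃ u ∈ e '' O, ∃ w ∈ e '' O', H.Adj u w) ↔ ∃ u ∈ O, ∃ w ∈ O', G.Adj u w := by
      intro O'
      simp only [Set.exists_mem_image, e.map_adj_iff]
    constructor
    · rw [← h5, ← Set.ncard_image_of_injective _ he]
      congr 1
      ext O'
      constructor
      · rintro ⟨⟨O', hO', rfl⟩, hne, hw⟩
        exact ⟨O', ⟨hO', fun h => hne (by rw [h]), (hadj O').1 hw⟩, rfl⟩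
      · rintro ⟨O', ⟨hO', hne, hw⟩, rfl⟩
        exact ⟨⟨O', hO', rfl⟩, fun h => hne (he h), (hadj O').2 hw⟩
    · rintro _ ⟨O', hO', rfl⟩ hne hw _ ⟨u, hu, rfl⟩
      rw [neighborSet_iso, ← Set.image_inter e.injective,
        Set.ncard_image_of_injective _ e.injective]
      exact h6 O' hO' (fun h => hne (by rw [h])) ((hadj O').1 hw) u hu

theorem IsNaturalOrientation.comap (e : G ≃g H) {D : W → W → Prop}
    (hD : IsNaturalOrientation H D) : IsNaturalOrientation G fun x y => D (e x) (e y) := by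
  obtain ⟨a, b, hab, rfl⟩ := hD
  obtain ⟨a, rfl⟩ := e.surjective a
  obtain ⟨b, rfl⟩ := e.surjective b
  refine ⟨a, b, e.map_adj_iff.1 hab, ?_⟩
  ext x y
  constructor
  · rintro ⟨g, h1, h2⟩
    refine ⟨(autCongr e).symm g, e.injective ?_, e.injective ?_⟩
    · rw [← autCongr_apply, MulEquiv.apply_symm_apply, h1]
    · rw [← autCongr_apply, MulEquiv.apply_symm_apply, h2]
  · rintro ⟨g, rfl, rfl⟩
    exact ⟨autCongr e g, autCongr_apply e g a, autCongr_apply e g b⟩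

theorem IsAlternatingCycle.map (e : G ≃g H) {D : V → V → Prop} {D' : W → W → Prop}
    (hD : ∀ x y, D x y → D' (e x) (e y)) {C : G.Subgraph} (hC : IsAlternatingCycle D C) :
    IsAlternatingCycle D' (C.map e.toHom) := by
  obtain ⟨v, w, hw, heven, rfl, halt⟩ := hC
  have hinj : Function.Injective e.toHom := e.injective
  refine ⟨e.toHom v, w.map e.toHom, (SimpleGraph.Walk.isCycle_map_iff_of_injective hinj).2 hw,
    by rwa [SimpleGraph.Walk.length_map], SimpleGraph.Walk.toSubgraph_map _ _, fun i hi => ?_⟩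
  rw [SimpleGraph.Walk.length_map] at hi
  rw [SimpleGraph.Walk.getVert_map, SimpleGraph.Walk.getVert_map]
  exact ⟨fun h => hD _ _ ((halt i hi).1 h), fun h => hD _ _ ((halt i hi).2 h)⟩

theorem map_symm_map (e : G ≃g H) (C : H.Subgraph) : (C.map e.symm.toHom).map e.toHom = C := by
  rw [← SimpleGraph.Subgraph.map_comp]
  convert SimpleGraph.Subgraph.map_id C
  ext x
  exact e.apply_symm_apply x

theorem HasRadius.of_iso (e : G ≃g H) {k : ℕ} (h : HasRadius G k) : HasRadius H k := by
  intro D hD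
  obtain ⟨⟨C, hC⟩, h2⟩ := h _ (hD.comap e)
  refine ⟨⟨_, hC.map e (D' := D) fun _ _ h => h⟩, fun C hC => ?_⟩
  rw [← h2 _ (hC.map e.symm fun x y hxy => by
      rwa [e.apply_symm_apply, e.apply_symm_apply]), SimpleGraph.Subgraph.map_verts]
  exact (Set.ncard_image_of_injective _ e.symm.injective).symm

theorem HasAttachmentNumber.of_iso (e : G ≃g H) {k : ℕ} (h : HasAttachmentNumber G k) :
    HasAttachmentNumber H k := by
  intro D hD
  obtain ⟨⟨C, C', hC, hC', hne, hm⟩, h2⟩ := h _ (hD.comap e)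
  have inter_map : ∀ C C' : G.Subgraph, (C.map e.toHom).verts ∩ (C'.map e.toHom).verts =
      e '' (C.verts ∩ C'.verts) := fun C C' => by
    rw [Set.image_inter e.injective]
    rfl
  have ncard_map : ∀ C C' : G.Subgraph,
      ((C.map e.toHom).verts ∩ (C'.map e.toHom).verts).ncard = (C.verts ∩ C'.verts).ncard :=
    fun C C' => by rw [inter_map, Set.ncard_image_of_injective _ e.injective]
  have hback : ∀ C : H.Subgraph, IsAlternatingCycle D C → ∃ C₀ : G.Subgraph,
      IsAlternatingCycle (fun x y => D (e x) (e y)) C₀ ∧ C₀.map e.toHom = C := fun C hC =>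
    ⟨_, hC.map e.symm fun x y hxy => by rwa [e.apply_symm_apply, e.apply_symm_apply],
      map_symm_map e C⟩
  refine ⟨⟨_, _, hC.map e (D' := D) fun _ _ h => h, hC'.map e (D' := D) fun _ _ h => h,
    fun h => hne ?_, ?_⟩, fun C C' hC hC' hne hm => ?_⟩
  · rw [← map_symm_map e.symm C, ← map_symm_map e.symm C']
    exact congrArg (SimpleGraph.Subgraph.map e.symm.toHom) h
  · rw [inter_map]
    exact hm.image e
  · obtain ⟨C₁, hC₁, rfl⟩ := hback C hC
    obtain ⟨C₂, hC₂, rfl⟩ := hback C' hC'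
    rw [inter_map, Set.image_nonempty] at hm
    rw [ncard_map]
    exact h2 C₁ C₂ hC₁ hC₂ (fun h => hne (by rw [h])) hm

theorem not_isTightlyAttached [Nonempty V] {k l : ℕ} (hkl : k ≠ l) (hq : IsQuartic G)
    (hr : HasRadius G k) (ha : HasAttachmentNumber G l) : ¬ IsTightlyAttached G := by
  rintro ⟨m, hr', ha'⟩
  obtain ⟨x⟩ := ‹Nonempty V›
  obtain ⟨y, hy⟩ : (G.neighborSet x).Nonempty :=
    Set.nonempty_of_ncard_ne_zero (by rw [hq x]; norm_num)
  have hD : IsNaturalOrientation G (arcOrbit G x y) := ⟨x, y, hy, rfl⟩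
  obtain ⟨C, hC⟩ := (hr _ hD).1
  obtain ⟨C₁, C₂, h1, h2, hne, hm⟩ := (ha _ hD).1
  have e1 := ((hr _ hD).2 C hC).symm.trans ((hr' _ hD).2 C hC)
  have e2 := ((ha _ hD).2 C₁ C₂ h1 h2 hne hm).symm.trans ((ha' _ hD).2 C₁ C₂ h1 h2 hne hm)
  omega

end Transport

/-! ### The cover -/

section Cover

/-- The lift of a permutation to `V × ℤ_p` that adds `1` to the second coordinate. -/
def liftPerm {V : Type*} (p : ℕ) (a : Equiv.Perm V) : Equiv.Perm (V × ZMod p) :=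
  a.prodCongr (Equiv.addRight 1)

theorem liftPerm_apply {V : Type*} (p : ℕ) (a : Equiv.Perm V) (x : V) (k : ZMod p) :
    liftPerm p a (x, k) = (a x, k + 1) := rfl

theorem liftPerm_pow_apply {V : Type*} (p : ℕ) (a : Equiv.Perm V) (m : ℕ) (x : V × ZMod p) :
    (liftPerm p a ^ m) x = ((a ^ m) x.1, x.2 + m) := by
  induction m with
  | zero => simp
  | succ m ih =>
    rw [pow_succ', pow_succ', Equiv.Perm.mul_apply, ih, liftPerm_apply, Nat.cast_succ, add_assoc,
      Equiv.Perm.mul_apply]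

theorem stepArc_liftPerm {V : Type*} (p : ℕ) (a b : Equiv.Perm V) (x y : V × ZMod p) :
    StepArc (liftPerm p a) (liftPerm p b) x y ↔ StepArc a b x.1 y.1 ∧ y.2 = x.2 + 1 := by
  obtain ⟨x, k⟩ := x
  obtain ⟨y, l⟩ := y
  rw [StepArc, liftPerm_apply, liftPerm_apply, Prod.mk.injEq, Prod.mk.injEq, ← or_and_right,
    StepArc]

/-- The identification of `ℤ_48` with `ℤ_48 × ℤ_1`, by which `X` is one of the graphs
`torusGraph`. -/
def chiX : ZMod 48 ≃+* ZMod 48 × ZMod 1 := RingEquiv.prodZeroRing (ZMod 48) (ZMod 1)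

/-- The steps inside the layers of `X`. -/
def stepAX : Equiv.Perm (ZMod 4 × ZMod 48) := stepA chiX

/-- The steps between the layers of `X`. -/
def stepBX : Equiv.Perm (ZMod 4 × ZMod 48) := stepB chiX

theorem rigidSystem_graphX : RigidSystem graphX stepAX stepBX :=
  rigidSystem_torusGraph chiX (Or.inl rfl)

theorem orientX_eq : orientX = StepArc stepAX stepBX :=
  rigidSystem_graphX.arcOrbit_eq (Or.inl rfl)

variable {p : ℕ}

theorem coverX_adj_iff (x y : (ZMod 4 × ZMod 48) × ZMod p) : (coverX p).Adj x y ↔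
    StepArc (liftPerm p stepAX) (liftPerm p stepBX) x y ∨
    StepArc (liftPerm p stepAX) (liftPerm p stepBX) y x := by
  rw [stepArc_liftPerm, stepArc_liftPerm]
  change graphX.Adj x.1 y.1 ∧ y.2 = x.2 + (unitVoltage orientX p).volt x.1 y.1 ↔ _
  rw [rigidSystem_graphX.adj_iff, orientX_eq]
  by_cases h : StepArc stepAX stepBX x.1 y.1
  · have h' := rigidSystem_graphX.asymm _ _ h
    simp [unitVoltage, h, h']
  · by_cases h' : StepArc stepAX stepBX y.1 x.1
    · simp only [unitVoltage, h, h', if_true, if_false, true_and, false_and, or_true, false_or,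
        zero_sub]
      rw [← sub_eq_add_neg, eq_sub_iff_add_eq, eq_comm]
    · simp [h, h']

variable (χ : ZMod (48 * p) ≃+* ZMod 48 × ZMod p)

/-- The bijection from the cover of `X` to the vertices of a graph `Y(4, 48p; r, t)`. Subtracting
the number of the layer from the last coordinate turns the voltage `1` of the steps between
consecutive layers into `0`. -/
def coverEquiv : (ZMod 4 × ZMod 48) × ZMod p ≃ ZMod 4 × ZMod (48 * p) where
  toFun x := (x.1.1, χ.symm (x.1.2, x.2 - x.1.1.val))
  invFun y := ((y.1, (χ y.2).1), (χ y.2).2 + y.1.val)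
  left_inv x := by simp
  right_inv y := by simp

theorem coverEquiv_apply (i : ZMod 4) (j : ZMod 48) (k : ZMod p) :
    coverEquiv χ ((i, j), k) = (i, χ.symm (j, k - i.val)) := rfl

theorem map_isLast (i : ZMod 4) : χ (isLast (48 * p) i) = (isLast 48 i, isLast p i) := by
  rw [isLast, isLast, isLast]
  split_ifs
  · exact map_one χ
  · exact map_zero χ

theorem coverEquiv_stepA (x : (ZMod 4 × ZMod 48) × ZMod p) :
    coverEquiv χ (liftPerm p stepAX x) = stepA χ (coverEquiv χ x) := by
  obtain ⟨⟨i, j⟩, k⟩ := x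
  have h : stepAX (i, j) = (i, j + (1 + 12 * (i.val : ZMod 48))) := rfl
  rw [liftPerm_apply, h, coverEquiv_apply, coverEquiv_apply, stepA_apply]
  refine Prod.ext rfl (χ.injective ?_)
  simp only [nilp, map_add, map_mul, map_one, map_natCast, RingEquiv.apply_symm_apply]
  refine Prod.ext rfl ?_
  change k + 1 - (i.val : ZMod p) = k - i.val + (1 + 0 * (i.val : ZMod p))
  ring

theorem coverEquiv_stepB (x : (ZMod 4 × ZMod 48) × ZMod p) :
    coverEquiv χ (liftPerm p stepBX x) = stepB χ (coverEquiv χ x) := by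
  obtain ⟨⟨i, j⟩, k⟩ := x
  have h : stepBX (i, j) = (i + 1, j + 4 * -1 * isLast 48 i) := rfl
  rw [liftPerm_apply, h, coverEquiv_apply, coverEquiv_apply, stepB_apply]
  refine Prod.ext rfl (χ.injective ?_)
  simp only [sgn, map_add, map_mul, map_ofNat, map_isLast, RingEquiv.apply_symm_apply]
  refine Prod.ext rfl ?_
  change k + 1 - ((i + 1).val : ZMod p) = k - i.val + 4 * 1 * isLast p i
  rw [val_add_one]
  ring

/-- The cover of `X` is a graph `Y(4, 48p; r, t)`. -/
def coverIso : coverX p ≃g torusGraph χ where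
  toEquiv := coverEquiv χ
  map_rel_iff' {x y} := by
    have h : ∀ x y, StepArc (stepA χ) (stepB χ) (coverEquiv χ x) (coverEquiv χ y) ↔
        StepArc (liftPerm p stepAX) (liftPerm p stepBX) x y := fun x y => by
      rw [StepArc, ← coverEquiv_stepA, ← coverEquiv_stepB, (coverEquiv χ).injective.eq_iff,
        (coverEquiv χ).injective.eq_iff, StepArc]
    rw [torusGraph_adj_iff, coverX_adj_iff, h, h]

theorem coverX_commutes_or_exchanges [NeZero p] (hp : ¬ p ∣ 8) (hcop : Nat.Coprime 48 p)
    (g : coverX p ≃g coverX p) :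
    Commutes (liftPerm p stepAX) (liftPerm p stepBX) g ∨
    Exchanges (liftPerm p stepAX) (liftPerm p stepBX) g := by
  let χ := ZMod.chineseRemainder hcop
  have hA : ∀ x, coverIso χ (liftPerm p stepAX x) = stepA χ (coverIso χ x) := coverEquiv_stepA χ
  have hB : ∀ x, coverIso χ (liftPerm p stepBX x) = stepB χ (coverIso χ x) := coverEquiv_stepB χ
  refine (commutes_or_exchanges χ (Or.inr hp) (autCongr (coverIso χ) g)).imp
    (fun h x => ?_) fun h x => ?_
  · have := h (coverIso χ x)
    rw [← hA, ← hB, autCongr_apply, autCongr_apply, autCongr_apply, ← hA, ← hB] at this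
    exact ⟨(coverIso χ).injective this.1, (coverIso χ).injective this.2⟩
  · have := h (coverIso χ x)
    rw [← hA, ← hB, autCongr_apply, autCongr_apply, autCongr_apply, ← hA, ← hB] at this
    exact ⟨(coverIso χ).injective this.1, (coverIso χ).injective this.2⟩

/-! ### Lifting and projecting automorphisms -/

theorem exists_lift (h : graphX ≃g graphX) :
    ∃ g : coverX p ≃g coverX p, ∀ x, (g x).1 = h x.1 :=
  ⟨isoOfStepArc coverX_adj_iff (h.toEquiv.prodCongr (Equiv.refl _)) fun x y => by
    rw [stepArc_liftPerm, stepArc_liftPerm]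
    exact and_congr_left' (rigidSystem_graphX.stepArc_iff h _ _), fun _ => rfl⟩

theorem stepAX_pow : stepAX ^ 48 = 1 := by
  ext1 x
  rw [stepAX, stepA_pow_apply]
  have : ((48 : ℕ) : ZMod 48) = 0 := by decide
  rw [this, zero_mul, add_zero]
  rfl

theorem stepBX_pow : stepBX ^ 48 = 1 := by
  ext1 x
  have h := apply_pow_eq (g := flipIso chiX) (c := stepAX) (d := stepBX)
    (fun x => (flipIso_exchanges chiX x).1) 48 (flipIso chiX x)
  rw [stepAX_pow, flipIso_flipIso, Equiv.Perm.one_apply, flipIso_flipIso] at h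
  exact h.symm

/-- The power `a⁴⁸ = b⁴⁸` of the lifted steps preserves every fibre and acts transitively on it, so
automorphisms permute the fibres. -/
theorem fst_apply_eq [NeZero p] (hp : ¬ p ∣ 8) (hcop : Nat.Coprime 48 p)
    (g : coverX p ≃g coverX p) (x : ZMod 4 × ZMod 48) (k l : ZMod p) :
    (g (x, k)).1 = (g (x, l)).1 := by
  have hA : ∀ y : (ZMod 4 × ZMod 48) × ZMod p,
      (liftPerm p stepAX ^ 48) y = (y.1, y.2 + (48 : ℕ)) := fun y => by
    rw [liftPerm_pow_apply, stepAX_pow, Equiv.Perm.one_apply]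
  have hB : ∀ y : (ZMod 4 × ZMod 48) × ZMod p,
      (liftPerm p stepBX ^ 48) y = (y.1, y.2 + (48 : ℕ)) := fun y => by
    rw [liftPerm_pow_apply, stepBX_pow, Equiv.Perm.one_apply]
  have h1 : ∀ k, (g (x, k + (48 : ℕ))).1 = (g (x, k)).1 := fun k => by
    rcases coverX_commutes_or_exchanges hp hcop g with h | h
    · have := apply_pow_eq (fun y => (h y).1) 48 (x, k)
      rw [hA, hA] at this
      rw [this]
    · have := apply_pow_eq (fun y => (h y).1) 48 (x, k)
      rw [hA, hB] at this
      rw [this]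
  have h2 : ∀ m : ℕ, (g (x, k + (48 : ℕ) * m)).1 = (g (x, k)).1 := fun m => by
    induction m with
    | zero => simp
    | succ m ih => rw [← ih, Nat.cast_succ m, mul_add, mul_one, ← add_assoc, h1]
  have h3 := h2 ((((48 : ℕ) : ZMod p)⁻¹ * (l - k)).val)
  rw [ZMod.natCast_zmod_val, ← mul_assoc, ZMod.coe_mul_inv_eq_one 48 hcop, one_mul,
    add_sub_cancel] at h3
  exact h3.symm

theorem exists_adj_coverX {x y : ZMod 4 × ZMod 48} (h : graphX.Adj x y) :
    ∃ k : ZMod p, (coverX p).Adj (x, 0) (y, k) := by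
  rcases (rigidSystem_graphX.adj_iff x y).1 h with h | h
  · exact ⟨1, (coverX_adj_iff _ _).2 (Or.inl ((stepArc_liftPerm _ _ _ _ _).2
      ⟨h, (zero_add 1).symm⟩))⟩
  · exact ⟨-1, (coverX_adj_iff _ _).2 (Or.inr ((stepArc_liftPerm _ _ _ _ _).2
      ⟨h, (neg_add_cancel 1).symm⟩))⟩

theorem exists_projection [NeZero p] (hp : ¬ p ∣ 8) (hcop : Nat.Coprime 48 p)
    (g : coverX p ≃g coverX p) : ∃ h : graphX ≃g graphX, ∀ x, (g x).1 = h x.1 := by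
  have hfib : ∀ (g : coverX p ≃g coverX p) (x : (ZMod 4 × ZMod 48) × ZMod p),
      (g x).1 = (g (x.1, 0)).1 := fun g x => fst_apply_eq hp hcop g x.1 x.2 0
  have hinv : ∀ (g : coverX p ≃g coverX p) (x : ZMod 4 × ZMod 48),
      (g.symm ((g (x, 0)).1, 0)).1 = x := fun g x => by
    rw [← hfib, g.symm_apply_apply]
  have hadj : ∀ (g : coverX p ≃g coverX p) (x y : ZMod 4 × ZMod 48), graphX.Adj x y →
      graphX.Adj (g (x, 0)).1 (g (y, 0)).1 := fun g x y hxy => by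
    obtain ⟨k, hk⟩ := exists_adj_coverX (p := p) hxy
    rw [← hfib g (y, k)]
    exact (g.map_adj_iff.2 hk).1
  refine ⟨{ toFun := fun x => (g (x, 0)).1
            invFun := fun x => (g.symm (x, 0)).1
            left_inv := hinv g
            right_inv := hinv g.symm
            map_rel_iff' := fun {x y} => ⟨fun h => ?_, hadj g x y⟩ }, hfib g⟩
  have := hadj g.symm _ _ h
  exact (hinv g x) ▸ (hinv g y) ▸ this

theorem coprime_of_prime (hp : p.Prime) (h5 : 5 ≤ p) : Nat.Coprime 48 p := by
  rw [show 48 = 2 ^ 4 * 3 by norm_num]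
  refine Nat.Coprime.mul_left (Nat.Coprime.pow_left 4 ?_) ?_
  · exact (Nat.coprime_primes Nat.prime_two hp).2 (by omega)
  · exact (Nat.coprime_primes Nat.prime_three hp).2 (by omega)

theorem not_dvd_eight (hp : p.Prime) (h5 : 5 ≤ p) : ¬ p ∣ 8 := by
  rw [show 8 = 2 ^ 3 by norm_num]
  intro h
  have := Nat.le_of_dvd (by norm_num) (hp.dvd_of_dvd_pow h)
  omega

/-- The properties of the covers, which are invariant under isomorphisms. -/
theorem coverX_properties (hp : p.Prime) (h5 : 5 ≤ p) :
    (coverX p).Connected ∧ IsQuartic (coverX p) ∧ IsHalfArcTransitive (coverX p) ∧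
      IsWeakMetacirculantClassII (coverX p) 4 (48 * p) ∧ HasRadius (coverX p) 12 ∧
      HasAttachmentNumber (coverX p) 3 ∧ ¬ IsTightlyAttached (coverX p) := by
  have : NeZero p := ⟨hp.ne_zero⟩
  have hp8 := not_dvd_eight hp h5
  let χ := ZMod.chineseRemainder (coprime_of_prime hp h5)
  let e := (coverIso χ).symm
  have hq := (isQuartic_torusGraph χ).of_iso e
  have hr := (hasRadius_and_hasAttachmentNumber_torusGraph χ (Or.inr hp8)).1.of_iso e
  have ha := (hasRadius_and_hasAttachmentNumber_torusGraph χ (Or.inr hp8)).2.of_iso e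
  exact ⟨e.connected_iff.1 (connected_torusGraph χ), hq,
    (isHalfArcTransitive_torusGraph χ (Or.inr hp8)).of_iso e,
    (isWeakMetacirculantClassII_torusGraph χ (by omega)).of_iso e, hr, ha,
    not_isTightlyAttached (by norm_num) hq hr ha⟩

theorem coverX_iso_graphY (hp : p.Prime) (h5 : 5 ≤ p) : ∃ r t : ZMod (48 * p),
    (r.val ≡ 13 [MOD 48] ∧ r.val ≡ 1 [MOD p] ∧ t.val ≡ 44 [MOD 48] ∧ t.val ≡ 4 [MOD p]) ∧
    (IsUnit r ∧ r ^ 4 = 1 ∧ t * (r - 1) = 0) ∧ Nonempty (coverX p ≃g graphY 4 (48 * p) r t) := by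
  have : NeZero p := ⟨hp.ne_zero⟩
  let χ := ZMod.chineseRemainder (coprime_of_prime hp h5)
  have hval : ∀ (z : ZMod 48 × ZMod p), ((χ.symm z).val : ZMod 48) = z.1 ∧
      ((χ.symm z).val : ZMod p) = z.2 := fun z => by
    have h := map_natCast χ (χ.symm z).val
    rw [ZMod.natCast_zmod_val, RingEquiv.apply_symm_apply] at h
    exact ⟨(congrArg Prod.fst h).symm, (congrArg Prod.snd h).symm⟩
  refine ⟨χ.symm (13, 1), χ.symm (44, 4), ⟨?_, ?_, ?_, ?_⟩, ⟨?_, ?_, ?_⟩, ⟨coverIso χ⟩⟩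
  · rw [← ZMod.natCast_eq_natCast_iff, (hval _).1]
    rfl
  · rw [← ZMod.natCast_eq_natCast_iff, (hval _).2, Nat.cast_one]
  · rw [← ZMod.natCast_eq_natCast_iff, (hval _).1]
    rfl
  · rw [← ZMod.natCast_eq_natCast_iff, (hval _).2, Nat.cast_ofNat]
  · rw [one_add_nil]
    exact (multUnit χ).isUnit
  · rw [one_add_nil]
    linear_combination (6 + 4 * nilp χ + nilp χ ^ 2) * nil_mul_nil χ + four_mul_nil χ
  · rw [one_add_nil, four_mul_sgn]
    linear_combination sgn χ * four_mul_nil χ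

end Cover

theorem mainTheorem5 :
    IsHalfArcTransitive graphX ∧
    (∀ p : ℕ, p.Prime → 5 ≤ p →
      (∃ r t : ZMod (48 * p),
        (r.val ≡ 13 [MOD 48] ∧ r.val ≡ 1 [MOD p] ∧ t.val ≡ 44 [MOD 48] ∧ t.val ≡ 4 [MOD p]) ∧
        (IsUnit r ∧ r ^ 4 = 1 ∧ t * (r - 1) = 0) ∧
        Nonempty (coverX p ≃g graphY 4 (48 * p) r t)) ∧
      (∀ h : graphX ≃g graphX, ∃ g : coverX p ≃g coverX p, ∀ x, (g x).1 = h x.1) ∧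
      (∀ g : coverX p ≃g coverX p, ∃ h : graphX ≃g graphX, ∀ x, (g x).1 = h x.1) ∧
      (coverX p).Connected ∧
      IsQuartic (coverX p) ∧
      IsHalfArcTransitive (coverX p) ∧
      IsWeakMetacirculantClassII (coverX p) 4 (48 * p) ∧
      HasRadius (coverX p) 12 ∧
      HasAttachmentNumber (coverX p) 3 ∧
      ¬ IsTightlyAttached (coverX p)) ∧
    {N : ℕ | ∃ G : SimpleGraph (Fin N), G.Connected ∧ IsQuartic G ∧ IsHalfArcTransitive G ∧
      (∃ m n : ℕ, IsWeakMetacirculantClassII G m n) ∧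
      HasRadius G 12 ∧ HasAttachmentNumber G 3 ∧ ¬ IsTightlyAttached G}.Infinite := by
  refine ⟨rigidSystem_graphX.isHalfArcTransitive, fun p hp h5 => ?_, ?_⟩
  · have : NeZero p := ⟨hp.ne_zero⟩
    exact ⟨coverX_iso_graphY hp h5, exists_lift,
      exists_projection (not_dvd_eight hp h5) (coprime_of_prime hp h5), coverX_properties hp h5⟩
  · refine Set.infinite_of_forall_exists_gt fun N => ?_
    obtain ⟨p, hpN, hp⟩ := Nat.exists_infinite_primes (N + 5)
    have h5 : 5 ≤ p := by omega
    have : NeZero p := ⟨hp.ne_zero⟩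
    have hcard : Fintype.card ((ZMod 4 × ZMod 48) × ZMod p) = 4 * 48 * p := by
      rw [Fintype.card_prod, Fintype.card_prod, ZMod.card, ZMod.card, ZMod.card]
    let e := (coverX p).overFinIso hcard
    obtain ⟨h1, h2, h3, h4, h6, h7, -⟩ := coverX_properties hp h5
    have : Nonempty (Fin (4 * 48 * p)) := ⟨⟨0, by omega⟩⟩
    exact ⟨4 * 48 * p, ⟨(coverX p).overFin hcard, e.connected_iff.1 h1, h2.of_iso e, h3.of_iso e,
      ⟨4, 48 * p, h4.of_iso e⟩, h6.of_iso e, h7.of_iso e,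
      not_isTightlyAttached (by norm_num) (h2.of_iso e) (h6.of_iso e) (h7.of_iso e)⟩, by omega⟩
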